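/- A hypergraph $\mathcal{H}$ (without repeated hyperedges) is a Berge-$F$, for a graph $F$, if there are an injection $\varphi: V(F)\to V(\mathcal{H})$ and a bijection $f:E(F)\to E(\mathcal{H})$ such that $\varphi(e)\subseteq f(e)$ for every $e\in E(F)$. A hypergraph is Berge-$F$-free if none of its subhypergraphs is a Berge-$F$, and $\mathrm{ex}_r(n,\text{Berge-}F)$ denotes the maximum number of hyperedges in an $r$-uniform Berge-$F$-free hypergraph on $n$ vertices. Let $K_{2,t}$ be the complete bipartite graph with parts of sizes $2$ and $t$. **Theorem.** Let $r\ge 1$ and $t\ge 2$ be fixed integers; $o(1)$ denotes a quantity (depending on $r$, $t$ and $n$) that tends to $0$ as $n\to\infty$ with $r,t$ fixed. (a) If $t\ge r+1$, then $$\mathrm{ex}_r(n,\text{Berge-}K_{2,t})\le (1+o(1))\,\frac{\sqrt{t-1}\,\binom{t}{r-1}}{rt}\,n^{3/2}.$$ (b) If $t\le r$, then $$\mathrm{ex}_r(n,\text{Berge-}K_{2,t})\le (1+o(1))\,\frac{\sqrt{t-1}}{2}\,n^{3/2}.$$ (c) In particular, if $r=3$ and $t\ge 4$, then $$\mathrm{ex}_3(n,\text{Berge-}K_{2,t})=(1+o(1))\,\frac16\,(t-1)^{3/2}n^{3/2}.$$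 -/

import Mathlib

open Filter Topology

namespace BergeTuran

/-- The hypergraph `H` is a Berge-`F`: the graph `F` is copied onto the vertex set of `H` by an
injection `φ`, and there is a bijection `f : E(F) → E(H)` such that each edge of the copy is
contained in the hyperedge assigned to it. -/
def IsBerge {V W : Type*} (F : SimpleGraph W) (H : Hypergraph V) : Prop :=
  ∃ φ : W ↪ V, (∀ w, φ w ∈ H.vertexSet) ∧
    ∃ f : F.edgeSet ≃ H.edgeSet,
      ∀ e : F.edgeSet, ∀ w ∈ (e : Sym2 W), φ w ∈ (f e : Set V)

/-- The hypergraph `H` is Berge-`F`-free: no subhypergraph of `H` is a Berge-`F`. -/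
def BergeFree {V W : Type*} (F : SimpleGraph W) (H : Hypergraph V) : Prop :=
  ∀ H' : Hypergraph V, H'.vertexSet ⊆ H.vertexSet → H'.edgeSet ⊆ H.edgeSet → ¬ IsBerge F H'

/-- The hypergraph `H` is `r`-uniform: every hyperedge has exactly `r` vertices. -/
def IsUniform {n : ℕ} (r : ℕ) (H : Hypergraph (Fin n)) : Prop :=
  ∀ e ∈ H.edgeSet, e.ncard = r

/-- The possible numbers of hyperedges of an `n`-vertex `r`-uniform Berge-`F`-free hypergraph. -/
def bergeSizes {W : Type*} (r n : ℕ) (F : SimpleGraph W) : Set ℕ :=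
  {m | ∃ H : Hypergraph (Fin n), H.vertexSet = Set.univ ∧ IsUniform r H ∧ BergeFree F H ∧
    H.edgeSet.ncard = m}

/-- `ex_r(n, Berge-F)`: the maximum number of hyperedges in an `n`-vertex `r`-uniform
Berge-`F`-free hypergraph. -/
noncomputable def bergeEx {W : Type*} (r n : ℕ) (F : SimpleGraph W) : ℕ :=
  sSup (bergeSizes r n F)

/-- The supremum defining `bergeEx` is over a bounded set. -/
theorem bddAbove_bergeSizes {W : Type*} (r n : ℕ) (F : SimpleGraph W) :
    BddAbove (bergeSizes r n F) := by
  refine ⟨(Set.univ : Set (Set (Fin n))).ncard, ?_⟩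
  rintro m ⟨H, -, -, -, rfl⟩
  exact Set.ncard_le_ncard (Set.subset_univ _) (Set.toFinite _)

/-- When `F` has an edge, the supremum defining `bergeEx` is a maximum. -/
theorem isGreatest_bergeEx {W : Type*} (r n : ℕ) (F : SimpleGraph W) (hF : F.edgeSet.Nonempty) :
    IsGreatest (bergeSizes r n F) (bergeEx r n F) := by
  have hne : (bergeSizes r n F).Nonempty := by
    refine ⟨0, ⟨Set.univ, ∅, by simp⟩, rfl, by simp [IsUniform], ?_, by simp⟩
    rintro H' - hE ⟨φ, -, f, -⟩
    obtain ⟨e, he⟩ := hF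
    exact hE (f ⟨e, he⟩).2
  exact ⟨Nat.sSup_mem hne (bddAbove_bergeSizes r n F),
    fun m hm => le_csSup (bddAbove_bergeSizes r n F) hm⟩

/-- The complete bipartite graph `K_{2,t}`. -/
abbrev K2 (t : ℕ) : SimpleGraph (Fin 2 ⊕ Fin t) := completeBipartiteGraph (Fin 2) (Fin t)

end BergeTuran

/-! Upper bounds: compare hyperedges with the vertex pairs they contain. A set `S` of hyperedges of
maximal deficiency splits the hypergraph (`exists_matching_partition`): hyperedges outside `S`
receive private pairs, the blue edges, while the pairs inside members of `S`, the red edges, are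
matched injectively back into `S`. All red and blue edges thus lie in distinct hyperedges, so the
graph `G` they form contains no `K_{2,t}`, and the Kővári–Sós–Turán count gives it at most about
`√(t-1)/2 · n^{3/2}` edges. Members of `S` are `r`-cliques of the red graph, and a red edge lies in
at most `C(t-1, r-2)` of these. Hence blue edges have weight 1 and red edges weight `2C(t-1,
r-2)/(r(r-1))`; the larger weight decides between (b) and (a).

Lower bound in (c): the triangles of a `K_{2,t}`-free graph form a Berge-`K_{2,t}`-free hypergraph.
With `k = t-1` and `k ∣ q-1`, `powGraph` over the field of `q` elements has `q(q-1)/k` vertices and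
codegrees at most `k`, attained by most adjacent pairs, which yields about `q³/6` triangles.

To reach every large `n`, a prime power `q ≡ 1 mod k` close to `√(kn)` is needed. Only existence in
each window `|log q - v| < δ` matters, so a one-sided Wiener–Ikehara argument suffices: test the
Dirichlet series of the von Mangoldt function on the class against a kernel that is nonpositive
outside `(-δ, δ)` but has positive integral. An empty window makes the sum nonpositive, whereas the
pole at `1` makes it positive in the limit. -/

namespace BergeTuran

/-! ### Prime powers in arithmetic progressions: the Fourier kernel. -/

section Analytic

open MeasureTheory Complex FourierTransform

/-- An even continuous function supported on `[-1, 1]` whose Fourier transform is integrable and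
nonpositive outside of `(-1, 1)`. -/
noncomputable def bump (t : ℝ) : ℝ :=
  3 * Real.pi * (1 - min |t| 1) * Real.cos (Real.pi * min |t| 1) + 5 * Real.sin (Real.pi * min |t| 1)

lemma continuous_bump : Continuous bump := by unfold bump; fun_prop

lemma bump_of_one_le {t : ℝ} (ht : 1 ≤ |t|) : bump t = 0 := by simp [bump, min_eq_right ht]

lemma bump_neg (t : ℝ) : bump (-t) = bump t := by simp [bump]

lemma bump_zero : bump 0 = 3 * Real.pi := by simp [bump]

lemma bump_of_mem {t : ℝ} (ht : t ∈ Set.uIcc (0:ℝ) 1) :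
    bump t = 3 * Real.pi * (1 - t) * Real.cos (Real.pi * t) + 5 * Real.sin (Real.pi * t) := by
  rw [Set.uIcc_of_le zero_le_one] at ht
  rw [bump, abs_of_nonneg ht.1, min_eq_left ht.2]

/-- Let `g` be the self-convolution of `cos (π t)` restricted to `[-1/2, 1/2]`. Then `bump =
(2/π)(4π² g + g'')`, so its transform is a square times `4π² - u²`, which changes sign only at `|u|
= 2π`. Clearing the denominator keeps the identity valid at `u = ±π`. -/
lemma integral_bump_mul_cos (u : ℝ) :
    (Real.pi ^ 2 - u ^ 2) ^ 2 * ∫ t in (0:ℝ)..1, bump t * Real.cos (u * t) =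
      (4 * Real.pi ^ 2 - u ^ 2) * (2 * Real.pi * (1 + Real.cos u)) := by
  rw [← intervalIntegral.integral_const_mul]
  rw [intervalIntegral.integral_eq_sub_of_hasDerivAt (f := fun t =>
    2 * (4 * Real.pi ^ 2 - u ^ 2) * (-Real.pi * (Real.cos (Real.pi * t) * Real.cos (u * t))
      - u * (Real.sin (Real.pi * t) * Real.sin (u * t)))
    - 3 * Real.pi * (Real.pi ^ 2 - u ^ 2) * (-Real.pi * (1 - t) * (Real.sin (Real.pi * t)
      * Real.cos (u * t)) + u * ((1 - t) * Real.cos (Real.pi * t) + Real.sin (Real.pi * t) / Real.pi)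
      * Real.sin (u * t)))]
  · simp
    ring
  · intro t ht
    rw [bump_of_mem ht]
    have hs (c : ℝ) : HasDerivAt (fun t => Real.sin (c * t)) (Real.cos (c * t) * c) t := by
      simpa using ((hasDerivAt_id t).const_mul c).sin
    have hc (c : ℝ) : HasDerivAt (fun t => Real.cos (c * t)) (-Real.sin (c * t) * c) t := by
      simpa using ((hasDerivAt_id t).const_mul c).cos
    have h1 : HasDerivAt (fun t : ℝ => 1 - t) (-1) t := by
      simpa using (hasDerivAt_id t).const_sub 1
    have := (((((hc Real.pi).mul (hc u)).const_mul (-Real.pi)).sub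
      (((hs Real.pi).mul (hs u)).const_mul u)).const_mul (2 * (4 * Real.pi ^ 2 - u ^ 2))).sub
      ((((h1.const_mul (-Real.pi)).mul ((hs Real.pi).mul (hc u))).add
      ((((h1.mul (hc Real.pi)).add ((hs Real.pi).div_const Real.pi)).const_mul u).mul
        (hs u))).const_mul (3 * Real.pi * (Real.pi ^ 2 - u ^ 2)))
    convert! this using 1
    simp only [Pi.mul_apply, Pi.add_apply]
    have := Real.pi_ne_zero
    field_simp
    ring
  · exact (continuous_const.mul (continuous_bump.mul (by fun_prop))).intervalIntegrable _ _

/-- The Fourier transform of `bump`. -/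
noncomputable def bumpFT (w : ℝ) : ℝ :=
  2 * ∫ t in (0:ℝ)..1, bump t * Real.cos (2 * Real.pi * w * t)

lemma hasCompactSupport_bump : HasCompactSupport (fun t => (bump t : ℂ)) := by
  refine HasCompactSupport.intro (isCompact_Icc (a := (-1:ℝ)) (b := 1)) fun t ht => ?_
  rw [bump_of_one_le, ofReal_zero]
  by_contra h
  exact ht (abs_le.1 (not_le.1 h).le)

lemma fourier_bump (w : ℝ) : 𝓕 (fun t => (bump t : ℂ)) w = bumpFT w := by
  rw [Real.fourier_eq' ]
  have h0 : ∀ t ∉ Set.Ioc (-1:ℝ) 1, cexp (↑(-2 * Real.pi * inner ℝ t w) * I) • (bump t : ℂ) = 0 := by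
    intro t ht
    rw [bump_of_one_le, ofReal_zero, smul_zero]
    by_contra h
    have := abs_lt.1 (not_le.1 h)
    exact ht ⟨this.1, this.2.le⟩
  rw [← setIntegral_eq_integral_of_forall_compl_eq_zero h0,
    ← intervalIntegral.integral_of_le (by norm_num)]
  have hcont : Continuous fun t : ℝ => cexp (↑(-2 * Real.pi * inner ℝ t w) * I) • (bump t : ℂ) := by
    have := continuous_bump
    fun_prop
  rw [← intervalIntegral.integral_add_adjacent_intervals (b := 0) (hcont.intervalIntegrable _ _)
    (hcont.intervalIntegrable _ _)]
  have : ∫ t in (-1:ℝ)..0, cexp (↑(-2 * Real.pi * inner ℝ t w) * I) • (bump t : ℂ) =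
      ∫ t in (0:ℝ)..1, cexp (↑(-2 * Real.pi * inner ℝ (-t) w) * I) • (bump (-t) : ℂ) := by
    rw [intervalIntegral.integral_comp_neg
      (fun t => cexp (↑(-2 * Real.pi * inner ℝ t w) * I) • (bump t : ℂ))]
    simp
  have hcont' : Continuous fun t : ℝ =>
    cexp (↑(-2 * Real.pi * inner ℝ (-t) w) * I) • (bump (-t) : ℂ) := hcont.comp continuous_neg
  rw [this, ← intervalIntegral.integral_add (hcont'.intervalIntegrable _ _)
    (hcont.intervalIntegrable _ _), bumpFT, ← intervalIntegral.integral_const_mul,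
    ← intervalIntegral.integral_ofReal]
  congr 1
  ext t
  rw [bump_neg]
  simp only [smul_eq_mul, RCLike.inner_apply, conj_trivial]
  push_cast
  rw [Complex.cos]
  ring_nf

lemma continuous_bumpFT : Continuous bumpFT := by
  unfold bumpFT
  refine continuous_const.mul ?_
  refine intervalIntegral.continuous_parametric_intervalIntegral_of_continuous' ?_ _ _
  have := continuous_bump
  fun_prop

lemma bumpFT_eq {w : ℝ} (hw : (2 * Real.pi * w) ^ 2 ≠ Real.pi ^ 2) :
    bumpFT w = 4 * Real.pi * (1 + Real.cos (2 * Real.pi * w)) *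
      (4 * Real.pi ^ 2 - (2 * Real.pi * w) ^ 2) / (Real.pi ^ 2 - (2 * Real.pi * w) ^ 2) ^ 2 := by
  have h := integral_bump_mul_cos (2 * Real.pi * w)
  have hD : Real.pi ^ 2 - (2 * Real.pi * w) ^ 2 ≠ 0 := fun h => hw (by linarith)
  rw [bumpFT, eq_div_iff (pow_ne_zero 2 hD)]
  linear_combination 2 * h

lemma bumpFT_nonpos {w : ℝ} (hw : 1 ≤ |w|) : bumpFT w ≤ 0 := by
  have hp := Real.pi_pos
  have h1 := (one_le_sq_iff_one_le_abs w).2 hw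
  have h2 : 4 * Real.pi ^ 2 ≤ (2 * Real.pi * w) ^ 2 := by nlinarith [sq_nonneg Real.pi]
  rw [bumpFT_eq (by nlinarith)]
  apply div_nonpos_of_nonpos_of_nonneg _ (sq_nonneg _)
  apply mul_nonpos_of_nonneg_of_nonpos
  · have := Real.neg_one_le_cos (2 * Real.pi * w)
    have : 0 ≤ 1 + Real.cos (2 * Real.pi * w) := by linarith
    positivity
  · linarith

lemma abs_bumpFT_le {w : ℝ} (hw : 1 ≤ |w|) : |bumpFT w| ≤ 3 * w⁻¹ ^ 2 := by
  have hp := Real.pi_gt_three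
  have h1 := (one_le_sq_iff_one_le_abs w).2 hw
  have hw0 : 0 < w ^ 2 := by linarith
  have e : (2 * Real.pi * w) ^ 2 = 4 * Real.pi ^ 2 * w ^ 2 := by ring
  have hp2 : 0 < Real.pi ^ 2 := by positivity
  have hne : (2 * Real.pi * w) ^ 2 ≠ Real.pi ^ 2 := by rw [e]; nlinarith
  have h3 := Real.cos_le_one (2 * Real.pi * w)
  have h4 := Real.neg_one_le_cos (2 * Real.pi * w)
  rw [abs_of_nonpos (bumpFT_nonpos hw), bumpFT_eq hne, e, inv_pow, ← neg_div,
    div_le_iff₀ (pow_two_pos_of_ne_zero (by rw [← e]; exact fun h => hne (by linarith))),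
    ← div_eq_mul_inv, div_mul_eq_mul_div, le_div_iff₀ hw0]
  generalize Real.cos (2 * Real.pi * w) = c at *
  generalize w ^ 2 = x at *
  have : 16 * Real.pi ^ 3 * ((1 + c) * ((x - 1) * x)) ≤ 16 * Real.pi ^ 3 * (2 * (x * x)) := by
    gcongr <;> nlinarith
  have h5 : Real.pi ^ 3 * (x * x) * 3 ≤ Real.pi ^ 3 * (x * x) * Real.pi := by gcongr
  -- This encodes `(4x - 1)² ≥ 9x²` for `x ≥ 1`; together with `π > 3` it makes the constant 3
  -- ample.
  have h6 : 0 ≤ Real.pi ^ 4 * ((x - 1) * (7 * x - 1)) := by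
    apply mul_nonneg (by positivity); nlinarith
  have h7 : 0 ≤ Real.pi ^ 3 * (x * x) := by positivity
  nlinarith

lemma integrable_bumpFT : Integrable bumpFT := by
  obtain ⟨M, hM⟩ := (isCompact_Icc (a := (-1:ℝ)) (b := 1)).exists_bound_of_continuousOn
    continuous_bumpFT.continuousOn
  have hM0 : 0 ≤ M := (norm_nonneg _).trans (hM 0 (by norm_num))
  refine (integrable_inv_one_add_sq.const_mul (2 * M + 6)).mono'
    continuous_bumpFT.aestronglyMeasurable (ae_of_all _ fun w => ?_)
  rw [← div_eq_mul_inv, le_div_iff₀ (by positivity)]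
  rcases le_total |w| 1 with h | h
  · have h1 := hM w (abs_le.1 h)
    have h2 : w ^ 2 ≤ 1 := by rw [← sq_abs]; nlinarith [abs_nonneg w]
    nlinarith [norm_nonneg (bumpFT w)]
  · have h1 := abs_bumpFT_le h
    have h2 := (one_le_sq_iff_one_le_abs w).2 h
    rw [Real.norm_eq_abs]
    rw [inv_pow, ← div_eq_mul_inv, le_div_iff₀ (by positivity)] at h1
    nlinarith [abs_nonneg (bumpFT w)]

/-- Fourier inversion at `0`: the integral is `bump 0 = 3π`. -/
lemma integral_bumpFT_pos : 0 < ∫ w, bumpFT w := by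
  have hc : Continuous fun t => (bump t : ℂ) := continuous_ofReal.comp continuous_bump
  have hF : 𝓕 (fun t => (bump t : ℂ)) = fun w => (bumpFT w : ℂ) := funext fourier_bump
  have h := hc.fourierInv_fourier_eq (hc.integrable_of_hasCompactSupport hasCompactSupport_bump)
    (by rw [hF]; exact integrable_bumpFT.ofReal)
  have h0 := congrFun h 0
  rw [hF, Real.fourierInv_eq'] at h0
  simp only [inner_zero_right, mul_zero, ofReal_zero, zero_mul, Complex.exp_zero, one_smul,
    bump_zero] at h0
  have : ∫ w, bumpFT w = 3 * Real.pi :=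
    ofReal_injective (integral_ofReal (f := bumpFT) (𝕜 := ℂ) |>.symm.trans h0)
  rw [this]; positivity

/-- For every `δ > 0` there is an integrable kernel with positive integral which is nonpositive
outside of `(-δ, δ)` and is the Fourier transform of a compactly supported continuous function. -/
lemma exists_fourier_kernel {δ : ℝ} (hδ : 0 < δ) : ∃ (φ : ℝ → ℂ) (K : ℝ → ℝ), Continuous φ ∧
    HasCompactSupport φ ∧ (∀ y : ℝ, ∫ t : ℝ, cexp (-(t * y) * I) * φ t = K y) ∧ Continuous K ∧
    Integrable K ∧ 0 < ∫ y, K y ∧ ∀ y, δ ≤ |y| → K y ≤ 0 := by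
  -- The kernel uses `e^{-ity}` without `2π`; this dilation absorbs the `2π` and moves the sign
  -- change from `1` to `δ`.
  set T : ℝ := 2 * Real.pi / δ with hT
  have hT0 : 0 < T := by positivity
  refine ⟨fun t => bump (t / T), fun y => T * bumpFT (y / δ), ?_, ?_, ?_, ?_, ?_, ?_, ?_⟩
  · have := continuous_bump
    fun_prop
  · refine HasCompactSupport.intro (isCompact_Icc (a := -T) (b := T)) fun t ht => ?_
    rw [bump_of_one_le, ofReal_zero]
    rw [abs_div, abs_of_pos hT0, one_le_div hT0]
    by_contra h
    exact ht (abs_le.1 (not_le.1 h).le)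
  · intro y
    have h := Measure.integral_comp_div (fun s : ℝ => cexp (-(T * s * y) * I) * bump s) T
    have e : ∀ t : ℝ, (T : ℂ) * ((t / T : ℝ) : ℂ) = t := fun t => by
      push_cast; field_simp [hT0.ne']
    simp only [e] at h
    rw [h, abs_of_pos hT0, ofReal_mul, ← fourier_bump, Real.fourier_eq', Complex.real_smul]
    congr 2
    ext s
    simp only [smul_eq_mul, RCLike.inner_apply, conj_trivial]
    congr 2
    rw [hT]; push_cast
    have : (δ : ℂ) ≠ 0 := ofReal_ne_zero.2 hδ.ne'
    field_simp
  · have := continuous_bumpFT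
    fun_prop
  · exact (integrable_bumpFT.comp_div hδ.ne').const_mul _
  · rw [integral_const_mul, Measure.integral_comp_div, smul_eq_mul, abs_of_pos hδ]
    have := integral_bumpFT_pos
    positivity
  · intro y hy
    refine mul_nonpos_of_nonneg_of_nonpos hT0.le (bumpFT_nonpos ?_)
    rwa [abs_div, abs_of_pos hδ, one_le_div hδ]

/-! ### A one-sided Tauberian argument. -/

section Tauberian

variable {φ : ℝ → ℂ} {K : ℝ → ℝ}

lemma norm_cexp_mul_I_eq_one (a b : ℝ) : ‖cexp (a * b * I)‖ = 1 := by
  rw [← ofReal_mul, norm_exp_ofReal_mul_I]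

/-- Integration term by term turns the factor `n^{-it} e^{itv}` into `K (log n - v)`. The
interchange is justified by absolute convergence at `1 + x` and the compact support of `φ`. -/
lemma hasSum_smoothed (hφ : Continuous φ) (hφc : HasCompactSupport φ)
    (hK : ∀ y : ℝ, ∫ t : ℝ, cexp (-(t * y) * I) * φ t = K y) {c : ℕ → ℝ} {x : ℝ} (v : ℝ)
    (hs : LSeriesSummable (fun n => (c n : ℂ)) ((1 + x : ℝ) : ℂ)) :
    HasSum (fun n : ℕ => if n = 0 then (0 : ℂ) else
        ((c n / (n : ℝ) ^ (1 + x) * K (Real.log n - v) : ℝ) : ℂ))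
      (∫ t : ℝ, φ t * cexp (t * v * I) * LSeries (fun n => (c n : ℂ)) (1 + x + t * I)) := by
  have hre (t : ℝ) : ((1 : ℂ) + x + t * I).re = 1 + x := by simp
  have hterm (t : ℝ) {n : ℕ} (hn : n ≠ 0) :
      LSeries.term (fun n => (c n : ℂ)) (1 + x + t * I) n =
        ((c n / (n : ℝ) ^ (1 + x) : ℝ) : ℂ) * cexp (-(t * Real.log n) * I) := by
    have hn0 : (n : ℂ) ≠ 0 := Nat.cast_ne_zero.2 hn
    rw [LSeries.term_of_ne_zero hn, Complex.cpow_add _ _ hn0, ← div_div, ofReal_div,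
      ofReal_cpow (Nat.cast_nonneg n), div_eq_mul_inv _ ((n : ℂ) ^ ((t : ℂ) * I)),
      ← Complex.cpow_neg, Complex.cpow_def_of_ne_zero hn0 (-(t * I)), natCast_log]
    push_cast
    congr 2
    ring
  have hint (n : ℕ) : Integrable fun t : ℝ =>
      φ t * cexp (t * v * I) * LSeries.term (fun n => (c n : ℂ)) (1 + x + t * I) n := by
    rcases eq_or_ne n 0 with rfl | hn
    · simp
    · simp only [hterm _ hn]
      refine Continuous.integrable_of_hasCompactSupport (by fun_prop) ?_
      exact (hφc.mul_right).mul_right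
  have hnorm (n : ℕ) (t : ℝ) :
      ‖φ t * cexp (t * v * I) * LSeries.term (fun n => (c n : ℂ)) (1 + x + t * I) n‖ =
      ‖φ t‖ * ‖LSeries.term (fun n => (c n : ℂ)) ((1 + x : ℝ) : ℂ) n‖ := by
    rw [norm_mul, norm_mul, norm_cexp_mul_I_eq_one, mul_one, LSeries.norm_term_eq,
      LSeries.norm_term_eq, hre, ofReal_re]
  have := hasSum_integral_of_summable_integral_norm hint (by
    simp only [hnorm, integral_mul_const]
    exact hs.norm.mul_left _)
  convert! this using 1
  · ext n
    rcases eq_or_ne n 0 with rfl | hn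
    · simp
    · rw [if_neg hn, ofReal_mul, ← hK, ← integral_const_mul]
      congr 1
      ext t
      rw [hterm _ hn, mul_left_comm (φ t * _), mul_assoc (φ t), ← Complex.exp_add, mul_comm (φ t)]
      congr 3
      push_cast
      ring
  · congr 1
    ext t
    rw [tsum_mul_left]
    rfl

/-- The contribution of the pole: write `1/(x + it)` as the integral of `e^{-(x+it)u}` over `u > 0`
and apply Fubini. -/
lemma integral_div_eq_integral_kernel (hφ : Continuous φ) (hφc : HasCompactSupport φ)
    (hK : ∀ y : ℝ, ∫ t : ℝ, cexp (-(t * y) * I) * φ t = K y) {x : ℝ} (hx : 0 < x) (v : ℝ) :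
    ∫ t : ℝ, φ t * cexp (t * v * I) / (x + t * I) =
      ((∫ u in Set.Ioi (0:ℝ), Real.exp (-x * u) * K (u - v) : ℝ) : ℂ) := by
  have h1 (t : ℝ) : φ t * cexp (t * v * I) / (x + t * I) =
      ∫ u in Set.Ioi (0:ℝ), φ t * cexp (t * v * I) * cexp (-(x + t * I) * u) := by
    rw [integral_const_mul, integral_exp_mul_complex_Ioi (by simpa using hx)]
    rw [ofReal_zero, mul_zero, Complex.exp_zero, neg_div_neg_eq, mul_one_div]
  simp only [h1]
  rw [integral_integral_swap, ← integral_complex_ofReal]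
  · refine integral_congr_ae (ae_of_all _ fun u => ?_)
    simp only
    rw [ofReal_mul, ← hK, ← integral_const_mul]
    congr 1
    ext t
    rw [mul_left_comm, mul_assoc (φ t), ← Complex.exp_add, mul_comm (φ t), ofReal_exp, ← mul_assoc,
      ← Complex.exp_add]
    congr 2
    push_cast
    ring
  · have := ((hφ.integrable_of_hasCompactSupport (μ := volume) hφc).norm).mul_prod
      (exp_neg_integrableOn_Ioi 0 hx).norm
    refine this.mono' ?_ (ae_of_all _ fun z => ?_)
    · have : Continuous fun z : ℝ × ℝ =>
          φ z.1 * cexp (z.1 * v * I) * cexp (-(x + z.1 * I) * z.2) := by fun_prop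
      exact this.aestronglyMeasurable
    · simp only [Function.uncurry, norm_mul, norm_cexp_mul_I_eq_one, mul_one]
      rw [Complex.norm_exp]
      simp

/-- Riemann–Lebesgue. For `h` not integrable the integrals take the default value `0`. -/
lemma tendsto_integral_exp_mul_atTop (h : ℝ → ℂ) :
    Tendsto (fun v : ℝ => ∫ t : ℝ, cexp (t * v * I) * h t) atTop (𝓝 0) := by
  have h1 : Tendsto (fun v : ℝ => -(v / (2 * Real.pi))) atTop (cocompact ℝ) :=
    (tendsto_neg_atTop_atBot.comp (tendsto_id.atTop_div_const (by positivity))).mono_right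
      atBot_le_cocompact
  refine ((Real.zero_at_infty_fourier h).comp h1).congr fun v => ?_
  rw [Function.comp_apply, Real.fourier_eq']
  congr 1
  ext t
  simp only [smul_eq_mul, RCLike.inner_apply, conj_trivial]
  congr 2
  have := Real.pi_ne_zero
  push_cast
  field_simp

/-- If a Dirichlet series with nonnegative coefficients, minus a simple pole at `1`,
extends continuously to the closed half plane `1 ≤ re s`, then its coefficients do not vanish
identically on `(e^(v-δ), e^(v+δ))`, for large `v`. -/
theorem eventually_exists_coeff_ne_zero {c : ℕ → ℝ} (hc : ∀ n, 0 ≤ c n) {G : ℂ → ℂ}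
    (hG : ContinuousOn G {s | 1 ≤ s.re}) {κ : ℝ} (hκ : 0 < κ)
    (hs : ∀ s : ℂ, 1 < s.re → LSeriesSummable (fun n => (c n : ℂ)) s)
    (hL : ∀ s : ℂ, 1 < s.re → LSeries (fun n => (c n : ℂ)) s = G s + κ / (s - 1))
    {δ : ℝ} (hδ : 0 < δ) :
    ∀ᶠ v : ℝ in atTop, ∃ n : ℕ, n ≠ 0 ∧ c n ≠ 0 ∧ |Real.log n - v| < δ := by
  obtain ⟨φ, K, hφ, hφc, hK, hKc, hKi, hKpos, hKneg⟩ := exists_fourier_kernel hδ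
  have hGx (x : ℝ) (hx : 0 ≤ x) : Continuous fun t : ℝ => G (1 + x + t * I) :=
    hG.comp_continuous (by fun_prop) fun t => by simpa using hx
  have hGi (x v : ℝ) (hx : 0 ≤ x) : Integrable fun t : ℝ =>
      φ t * cexp (t * v * I) * G (1 + x + t * I) := by
    exact Continuous.integrable_of_hasCompactSupport ((hφ.mul (by fun_prop)).mul (hGx x hx))
      hφc.mul_right.mul_right
  -- the inequality for positive `x`
  have key (v : ℝ) (hv : ¬ ∃ n : ℕ, n ≠ 0 ∧ c n ≠ 0 ∧ |Real.log n - v| < δ) (x : ℝ) (hx : 0 < x) :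
      (∫ t : ℝ, φ t * cexp (t * v * I) * G (1 + x + t * I)).re +
        κ * ∫ u in Set.Ioi (0:ℝ), Real.exp (-x * u) * K (u - v) ≤ 0 := by
    have hsum := (hasSum_smoothed hφ hφc hK v (hs ((1 + x : ℝ) : ℂ) (by simpa using hx))).mapL reCLM
    have hne (t : ℝ) : (x : ℂ) + t * I ≠ 0 := fun h => hx.ne' (by simpa using congrArg re h)
    have hcont2 : Integrable fun t : ℝ => (κ : ℂ) * (φ t * cexp (t * v * I) / (x + t * I)) := by
      refine Continuous.integrable_of_hasCompactSupport ?_ ?_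
      · exact continuous_const.mul (Continuous.div (by fun_prop) (by fun_prop) hne)
      · simp only [div_eq_mul_inv]
        exact (hφc.mul_right.mul_right).mul_left
    have e : ∫ t : ℝ, φ t * cexp (t * v * I) * LSeries (fun n => (c n : ℂ)) (1 + x + t * I) =
        (∫ t : ℝ, φ t * cexp (t * v * I) * G (1 + x + t * I)) +
          κ * ((∫ u in Set.Ioi (0:ℝ), Real.exp (-x * u) * K (u - v) : ℝ) : ℂ) := by
      rw [← integral_div_eq_integral_kernel hφ hφc hK hx v, ← integral_const_mul,
        ← integral_add (hGi x v hx.le) hcont2]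
      congr 1
      ext t
      rw [hL _ (by simpa using hx)]
      have : (1 : ℂ) + x + t * I - 1 = x + t * I := by ring
      rw [this]
      ring
    rw [e] at hsum
    -- Every term is nonpositive: either `c n = 0`, or `log n` is at distance at least `δ` from `v`,
    -- where `K ≤ 0`.
    have := hsum.nonpos fun n => ?_
    · simpa using this
    · simp only [reCLM_apply]
      split_ifs with hn
      · simp
      · rw [ofReal_re]
        by_cases hcn : c n = 0
        · simp [hcn]
        · refine mul_nonpos_of_nonneg_of_nonpos (div_nonneg (hc n) (by positivity)) (hKneg _ ?_)
          by_contra hlt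
          exact hv ⟨n, hn, hcn, not_le.1 hlt⟩
  -- the limit `x → 0`
  have key0 (v : ℝ) (hv : ¬ ∃ n : ℕ, n ≠ 0 ∧ c n ≠ 0 ∧ |Real.log n - v| < δ) :
      (∫ t : ℝ, cexp (t * v * I) * (φ t * G (1 + t * I))).re +
        κ * ∫ u in Set.Ioi (0:ℝ), K (u - v) ≤ 0 := by
    have l1 : Tendsto (fun x : ℝ => ∫ t : ℝ, φ t * cexp (t * v * I) * G (1 + x + t * I)) (𝓝[>] 0)
        (𝓝 (∫ t : ℝ, cexp (t * v * I) * (φ t * G (1 + t * I)))) := by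
      obtain ⟨C, hC⟩ := ((isCompact_Icc (a := (0:ℝ)) (b := 1)).prod hφc.isCompact).exists_bound_of_continuousOn
        (f := fun z : ℝ × ℝ => G (1 + z.1 + z.2 * I)) (hG.comp (by fun_prop) fun z hz => by
          simpa using hz.1.1)
      refine tendsto_integral_filter_of_dominated_convergence (fun t => ‖φ t‖ * C) ?_ ?_ ?_ ?_
      · filter_upwards [self_mem_nhdsWithin] with x hx
        exact (hGi x v (le_of_lt hx)).aestronglyMeasurable
      · filter_upwards [Ioc_mem_nhdsGT (zero_lt_one' ℝ)] with x hx
        refine ae_of_all _ fun t => ?_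
        rw [norm_mul, norm_mul, norm_cexp_mul_I_eq_one, mul_one]
        by_cases ht : t ∈ tsupport φ
        · exact mul_le_mul_of_nonneg_left (hC (x, t) ⟨⟨hx.1.le, hx.2⟩, ht⟩) (norm_nonneg _)
        · simp [image_eq_zero_of_notMem_tsupport ht]
      · exact (hφ.integrable_of_hasCompactSupport hφc).norm.mul_const C
      · refine ae_of_all _ fun t => ?_
        have : Tendsto (fun x : ℝ => G (1 + x + t * I)) (𝓝[>] 0) (𝓝 (G (1 + t * I))) := by
          refine (hG (1 + t * I) (by simp)).tendsto.comp (tendsto_nhdsWithin_iff.2 ⟨?_, ?_⟩)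
          · have : Continuous fun x : ℝ => (1 : ℂ) + x + t * I := by fun_prop
            simpa using (this.tendsto 0).mono_left nhdsWithin_le_nhds
          · filter_upwards [self_mem_nhdsWithin] with x hx
            simpa using (le_of_lt hx)
        convert this.const_mul (φ t * cexp (t * v * I)) using 2
        ring
    have l2 : Tendsto (fun x : ℝ => ∫ u in Set.Ioi (0:ℝ), Real.exp (-x * u) * K (u - v)) (𝓝[>] 0)
        (𝓝 (∫ u in Set.Ioi (0:ℝ), K (u - v))) := by
      refine tendsto_integral_filter_of_dominated_convergence (fun u => ‖K (u - v)‖) ?_ ?_ ?_ ?_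
      · exact Eventually.of_forall fun x => Continuous.aestronglyMeasurable (by fun_prop)
      · filter_upwards [self_mem_nhdsWithin] with x hx
        filter_upwards [ae_restrict_mem measurableSet_Ioi] with u hu
        rw [norm_mul, Real.norm_eq_abs, Real.abs_exp]
        refine mul_le_of_le_one_left (norm_nonneg _) (Real.exp_le_one_iff.2 ?_)
        have := mul_pos (Set.mem_Ioi.1 hx) (Set.mem_Ioi.1 hu)
        linarith
      · exact (hKi.comp_sub_right v).norm.integrableOn
      · refine ae_of_all _ fun u => ?_
        have : Continuous fun x : ℝ => Real.exp (-x * u) * K (u - v) := by fun_prop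
        simpa using (this.tendsto 0).mono_left nhdsWithin_le_nhds
    refine le_of_tendsto (((continuous_re.tendsto _).comp l1).add (l2.const_mul κ)) ?_
    filter_upwards [self_mem_nhdsWithin] with x hx
    exact key v hv x hx
  -- the limit `v → ∞`
  have l3 : Tendsto (fun v : ℝ => (∫ t : ℝ, cexp (t * v * I) * (φ t * G (1 + t * I))).re +
      κ * ∫ u in Set.Ioi (0:ℝ), K (u - v)) atTop (𝓝 ((0:ℂ).re + κ * ∫ u, K u)) := by
    refine ((continuous_re.tendsto _).comp (tendsto_integral_exp_mul_atTop _)).add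
      (Tendsto.const_mul κ ?_)
    refine ((aecover_Ioi tendsto_neg_atTop_atBot).integral_tendsto_of_countably_generated
      hKi).congr fun v => ?_
    rw [← integral_indicator measurableSet_Ioi, ← integral_indicator measurableSet_Ioi,
      ← integral_sub_right_eq_self _ v]
    congr 1
    ext u
    simp [Set.indicator_apply]
  -- The limit `κ ∫ K` is positive, so for large `v` the inequality `key0` of an empty window fails.
  filter_upwards [l3.eventually (lt_mem_nhds (show 0 < _ by simpa using mul_pos hκ hKpos))]
    with v hv
  by_contra hn
  exact absurd (key0 v hn) (not_le.2 hv)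

end Tauberian

/-- For a unit `a` modulo `m` and large `v` there is a prime power `q ≡ a` modulo `m` with
`|log q - v| < δ`. -/
theorem eventually_exists_isPrimePow {m : ℕ} [NeZero m] {a : ZMod m} (ha : IsUnit a) {δ : ℝ}
    (hδ : 0 < δ) : ∀ᶠ v : ℝ in atTop, ∃ q : ℕ, IsPrimePow q ∧ (q : ZMod m) = a ∧
      |Real.log q - v| < δ := by
  open ArithmeticFunction vonMangoldt in
  -- The coefficients are the von Mangoldt function on the class of `a`, supported on prime powers;
  -- the residue at `1` is `1/φ(m)`.
  have := eventually_exists_coeff_ne_zero (c := residueClass a) (residueClass_nonneg a)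
    (continuousOn_LFunctionResidueClassAux a) (κ := (m.totient : ℝ)⁻¹)
    (by have := Nat.totient_pos.2 (NeZero.pos m); positivity)
    (fun s hs => LSeriesSummable_of_abscissaOfAbsConv_lt_re <|
      (abscissaOfAbsConv_residueClass_le_one a).trans_lt <| by exact_mod_cast hs)
    (fun s hs => by rw [eqOn_LFunctionResidueClassAux ha hs]; push_cast; ring) hδ
  filter_upwards [this] with v hv
  obtain ⟨n, -, hn, hv⟩ := hv
  rw [residueClass, Set.indicator_apply_ne_zero] at hn
  exact ⟨n, vonMangoldt_ne_zero_iff.1 hn.2, hn.1, hv⟩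

end Analytic

/-! ### Deficiency version of Hall's theorem. -/

/-- A finite bipartite graph has a set `S` on one side such that the complement of `S` can be
matched outside of the neighbourhood of `S`, and the neighbourhood of `S` can be matched to `S`. -/
lemma exists_matching_partition {α β : Type*} [Fintype α] [DecidableEq α] [DecidableEq β]
    (N : α → Finset β) : ∃ (S : Finset α) (f : {a // a ∉ S} → β)
      (g : {b // b ∈ S.biUnion N} → α), Function.Injective f ∧
      (∀ a : {a // a ∉ S}, f a ∈ N a ∧ f a ∉ S.biUnion N) ∧ Function.Injective g ∧
      ∀ b, g b ∈ S ∧ (b : β) ∈ N (g b) := by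
  -- `S` maximises `|S| - |N(S)|`. Comparison with `S ∪ X` is Hall's condition for the complement of
  -- `S`; comparison with `S \ T` is Hall's condition for `N(S)`.
  obtain ⟨S, -, hS⟩ := Finset.exists_max_image (Finset.univ : Finset (Finset α))
    (fun S => (S.card : ℤ) - (S.biUnion N).card) Finset.univ_nonempty
  have hS' (T : Finset α) : (T.card : ℤ) + (S.biUnion N).card ≤ S.card + (T.biUnion N).card := by
    have := hS T (Finset.mem_univ _)
    linarith
  have h1 := (Finset.all_card_le_biUnion_card_iff_exists_injective
    (fun a : {a // a ∉ S} => N a \ S.biUnion N)).1 fun X => by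
      have h := hS' (S ∪ X.map (Function.Embedding.subtype _))
      rw [Finset.card_union_of_disjoint (by
        rw [Finset.disjoint_left]
        simp +contextual), Finset.card_map, Finset.union_biUnion] at h
      have h2 : S.biUnion N ∪ (X.map (Function.Embedding.subtype _)).biUnion N =
          S.biUnion N ∪ X.biUnion (fun a : {a // a ∉ S} => N a \ S.biUnion N) := by
        ext b
        simp only [Finset.mem_union, Finset.mem_biUnion, Finset.mem_map, Finset.mem_sdiff,
          Function.Embedding.subtype_apply]
        grind
      rw [h2] at h
      have := Finset.card_union_le (S.biUnion N)
        (X.biUnion (fun a : {a // a ∉ S} => N a \ S.biUnion N))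
      omega
  have h2 := (Finset.all_card_le_biUnion_card_iff_exists_injective
    (fun b : {b // b ∈ S.biUnion N} => S.filter (fun a => (b : β) ∈ N a))).1 fun Y => by
      set T := Y.biUnion (fun b : {b // b ∈ S.biUnion N} => S.filter (fun a => (b : β) ∈ N a))
        with hT
      have hTS : T ⊆ S := by
        intro a
        simp only [hT, Finset.mem_biUnion, Finset.mem_filter]
        rintro ⟨_, _, h, _⟩
        exact h
      have h := hS' (S \ T)
      rw [Finset.card_sdiff_of_subset hTS, Nat.cast_sub (Finset.card_le_card hTS)] at h
      have h3 : (S \ T).biUnion N ⊆ S.biUnion N \ Y.map (Function.Embedding.subtype _) := by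
        intro b hb
        simp only [Finset.mem_biUnion, Finset.mem_sdiff, hT, Finset.mem_filter, Finset.mem_map,
          Function.Embedding.subtype_apply] at hb ⊢
        grind
      have h4 : Y.map (Function.Embedding.subtype _) ⊆ S.biUnion N := by
        intro b
        simp only [Finset.mem_map, Function.Embedding.subtype_apply]
        rintro ⟨b, _, rfl⟩
        exact b.2
      have h5 := Finset.card_le_card h3
      rw [Finset.card_sdiff_of_subset h4, Finset.card_map] at h5
      have h6 := Finset.card_le_card h4
      rw [Finset.card_map] at h6
      omega
  obtain ⟨f, hf, hf'⟩ := h1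
  obtain ⟨g, hg, hg'⟩ := h2
  exact ⟨S, f, g, hf, fun a => Finset.mem_sdiff.1 (hf' a), hg, fun b => Finset.mem_filter.1 (hg' b)⟩

/-! ### Edges and cliques in graphs of bounded codegree. -/

section Graph

variable {V : Type*} [Fintype V] [DecidableEq V]

/-- In the graph `G` any two distinct vertices have at most `k` common neighbours. -/
def CodegreeLE (G : SimpleGraph V) [DecidableRel G.Adj] (k : ℕ) : Prop :=
  ∀ u v, u ≠ v → (Finset.univ.filter fun w => G.Adj u w ∧ G.Adj v w).card ≤ k

variable (G : SimpleGraph V) [DecidableRel G.Adj] {k : ℕ}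

/-- Cauchy–Schwarz on degrees. The sum of squared degrees counts walks `u, w, v`: those with `u = v`
number `2e`, and each pair `u ≠ v` contributes at most `k`. -/
lemma sq_two_mul_card_edgeFinset_le (hG : CodegreeLE G k) :
    (2 * G.edgeFinset.card) ^ 2 ≤
      Fintype.card V * (2 * G.edgeFinset.card + k * Fintype.card V ^ 2) := by
  rw [← G.sum_degrees_eq_twice_card_edges]
  refine (sq_sum_le_card_mul_sum_sq (s := Finset.univ) (f := fun v => G.degree v)).trans ?_
  rw [Finset.card_univ]
  refine Nat.mul_le_mul_left _ ?_
  have h1 : ∀ w, G.degree w ^ 2 = ∑ u, ∑ v, if G.Adj u w ∧ G.Adj v w then 1 else 0 := by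
    intro w
    have : G.degree w = ∑ u, if G.Adj u w then 1 else 0 := by
      rw [← Finset.card_filter, ← G.card_neighborFinset_eq_degree]
      congr 1
      ext
      simp [G.adj_comm]
    rw [sq, this, Finset.sum_mul_sum]
    refine Finset.sum_congr rfl fun u _ => Finset.sum_congr rfl fun v _ => ?_
    split_ifs <;> simp_all
  simp only [h1]
  rw [Finset.sum_comm, ← Finset.card_univ (α := V), sq, ← mul_assoc, mul_comm, ← smul_eq_mul (Finset.card _),
    ← Finset.sum_const, ← Finset.sum_add_distrib]
  refine Finset.sum_le_sum fun u _ => ?_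
  rw [Finset.sum_comm, ← Finset.add_sum_erase _ _ (Finset.mem_univ u)]
  refine Nat.add_le_add ?_ ?_
  · rw [← Finset.card_filter, ← G.card_neighborFinset_eq_degree]
    refine Finset.card_le_card fun w => ?_
    simp
  · refine (Finset.sum_le_card_nsmul _ _ k fun v hv => ?_).trans ?_
    · rw [← Finset.card_filter]
      exact hG u v (Finset.ne_of_mem_erase hv).symm
    · rw [smul_eq_mul, mul_comm]
      exact Nat.mul_le_mul_left _ (Finset.card_le_card (Finset.erase_subset _ _))

lemma mul_card_cliqueFinset_eq_sum (r : ℕ) : r * (r - 1) * (G.cliqueFinset r).card =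
    ∑ p ∈ Finset.univ.filter (fun p : V × V => G.Adj p.1 p.2),
      ((G.cliqueFinset r).filter fun c => p ∈ c.offDiag).card := by
  have h1 : r * (r - 1) * (G.cliqueFinset r).card = ∑ c ∈ G.cliqueFinset r, c.offDiag.card := by
    rw [mul_comm, ← smul_eq_mul, ← Finset.sum_const]
    refine Finset.sum_congr rfl fun c hc => ?_
    rw [Finset.offDiag_card, (SimpleGraph.mem_cliqueFinset_iff.1 hc).card_eq, Nat.mul_sub, mul_one]
  rw [h1]
  refine Eq.trans ?_ (Finset.sum_card_bipartiteAbove_eq_sum_card_bipartiteBelow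
    (fun (c : Finset V) (p : V × V) => p ∈ c.offDiag))
  refine Finset.sum_congr rfl fun c hc => ?_
  congr 1
  ext p
  simp only [Finset.bipartiteAbove, Finset.mem_filter, Finset.mem_univ, true_and,
    Finset.mem_offDiag]
  refine ⟨fun h => ⟨?_, h⟩, fun h => h.2⟩
  exact (SimpleGraph.mem_cliqueFinset_iff.1 hc).isClique h.1 h.2.1 h.2.2

/-- An `r`-clique through an edge is determined by its other `r - 2` vertices, which are common
neighbours of the endpoints. -/
lemma mul_card_cliqueFinset_le (hG : CodegreeLE G k) (r : ℕ) :
    r * (r - 1) * (G.cliqueFinset r).card ≤ 2 * G.edgeFinset.card * k.choose (r - 2) := by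
  have h3 : (Finset.univ.filter (fun p : V × V => G.Adj p.1 p.2)).card = 2 * G.edgeFinset.card := by
    rw [← G.sum_degrees_eq_twice_card_edges, Finset.card_filter, Fintype.sum_prod_type]
    refine Finset.sum_congr rfl fun v _ => ?_
    rw [← Finset.card_filter, ← G.card_neighborFinset_eq_degree]
    congr 1
    ext
    simp
  rw [mul_card_cliqueFinset_eq_sum G r, ← h3, ← smul_eq_mul (Finset.card _)]
  refine Finset.sum_le_card_nsmul _ _ _ fun p hp => ?_
  obtain ⟨u, v⟩ := p
  have huv : G.Adj u v := (Finset.mem_filter.1 hp).2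
  refine le_trans ?_ (Nat.choose_le_choose (r - 2) (hG u v huv.ne))
  rw [← Finset.card_powersetCard]
  refine Finset.card_le_card_of_injOn (fun c => (c.erase u).erase v) ?_ ?_
  · intro c hc
    simp only [Finset.coe_filter, Set.mem_ofPred_eq, SimpleGraph.mem_cliqueFinset_iff,
      Finset.mem_offDiag] at hc
    obtain ⟨hc, hu, hv, hne⟩ := hc
    rw [Finset.mem_coe, Finset.mem_powersetCard]
    refine ⟨fun w hw => ?_, ?_⟩
    · simp only [Finset.mem_erase] at hw
      rw [Finset.mem_filter]
      exact ⟨Finset.mem_univ _, hc.isClique hu hw.2.2 (Ne.symm hw.2.1),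
        hc.isClique hv hw.2.2 (Ne.symm hw.1)⟩
    · rw [Finset.card_erase_of_mem (Finset.mem_erase.2 ⟨Ne.symm hne, hv⟩),
        Finset.card_erase_of_mem hu, hc.card_eq]
      rfl
  · intro c hc d hd hcd
    simp only [Finset.coe_filter, Set.mem_ofPred_eq, Finset.mem_offDiag] at hc hd
    have := congrArg (fun s => insert u (insert v s)) hcd
    simp only at this
    rwa [Finset.insert_erase (Finset.mem_erase.2 ⟨Ne.symm hc.2.2.2, hc.2.2.1⟩),
      Finset.insert_erase (Finset.mem_erase.2 ⟨Ne.symm hd.2.2.2, hd.2.2.1⟩),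
      Finset.insert_erase hc.2.1, Finset.insert_erase hd.2.1] at this

end Graph

/-! ### From Berge hypergraphs to graphs and back. -/

section Berge

/-- If the edges of a graph `G` are contained in distinct hyperedges of a Berge-`K_{2,t}`-free
hypergraph, then two vertices of `G` have less than `t` common neighbours. -/
lemma BergeFree.codegreeLE {V : Type*} [Fintype V] [DecidableEq V] {H : Hypergraph V}
    (hV : H.vertexSet = Set.univ) {t : ℕ} (hH : BergeFree (K2 (t + 1)) H) (G : SimpleGraph V)
    [DecidableRel G.Adj] (F : G.edgeSet → H.edgeSet) (hF : Function.Injective F)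
    (hF' : ∀ e : G.edgeSet, ∀ x ∈ (e : Sym2 V), x ∈ (F e : Set V)) : CodegreeLE G t := by
  intro u v huv
  by_contra! hlt
  obtain ⟨ψ⟩ : Nonempty (Fin (t + 1) ↪ {w // w ∈ Finset.univ.filter fun w => G.Adj u w ∧ G.Adj v w}) :=
    Function.Embedding.nonempty_of_card_le (by rwa [Fintype.card_coe, Fintype.card_fin])
  have hψ (i) : G.Adj u (ψ i) ∧ G.Adj v (ψ i) := (Finset.mem_filter.1 (ψ i).2).2
  let φ : Fin 2 ⊕ Fin (t + 1) → V := Sum.elim ![u, v] (fun i => ψ i)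
  have hadj : ∀ (i : Fin 2) (j : Fin (t + 1)), G.Adj (φ (Sum.inl i)) (φ (Sum.inr j)) := by
    intro i j
    fin_cases i
    · exact (hψ j).1
    · exact (hψ j).2
  have hφ : Function.Injective φ := by
    rintro (i | i) (j | j) h
    · fin_cases i <;> fin_cases j <;> simp_all [φ]
    · exact absurd h (hadj i j).ne
    · exact absurd h.symm (hadj j i).ne
    · simpa [φ, Subtype.val_inj] using h
  have hom : ∀ {a b}, (K2 (t + 1)).Adj a b → G.Adj (φ a) (φ b) := by
    rintro (i | i) (j | j) h
    · simp at h
    · exact hadj i j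
    · exact (hadj j i).symm
    · simp at h
  let hm : K2 (t + 1) →g G := ⟨φ, hom⟩
  let m : (K2 (t + 1)).edgeSet → G.edgeSet := hm.mapEdgeSet
  have hm' : Function.Injective m := SimpleGraph.Hom.mapEdgeSet.injective hm hφ
  have hinj : Function.Injective fun e => ((F (m e) : H.edgeSet) : Set V) :=
    Subtype.val_injective.comp (hF.comp hm')
  refine hH ⟨Set.univ, Set.range fun e => ((F (m e) : H.edgeSet) : Set V),
    fun _ _ => Set.subset_univ _⟩ hV.ge ?_ ⟨⟨φ, hφ⟩, fun _ => Set.mem_univ _,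
      Equiv.ofInjective _ hinj, fun e w hw => ?_⟩
  · rintro _ ⟨e, rfl⟩
    exact (F (m e)).2
  · exact hF' (m e) _ (Sym2.mem_map.2 ⟨w, hw, rfl⟩)

/-- The hypergraph of the `r`-cliques of a graph without `K_{2,t}` is Berge-`K_{2,t}`-free. -/
lemma card_cliqueFinset_le_bergeEx {n t r : ℕ} (G : SimpleGraph (Fin n)) [DecidableRel G.Adj]
    (hG : CodegreeLE G t) : (G.cliqueFinset r).card ≤ bergeEx r n (K2 (t + 1)) := by
  refine le_csSup (bddAbove_bergeSizes r n _) ⟨⟨Set.univ,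
    (fun c : Finset (Fin n) => (c : Set (Fin n))) '' (G.cliqueFinset r : Set _),
    fun _ _ => Set.subset_univ _⟩, rfl, ?_, ?_, ?_⟩
  · rintro _ ⟨c, hc, rfl⟩
    rw [Set.ncard_coe_finset]
    exact (SimpleGraph.mem_cliqueFinset_iff.1 hc).card_eq
  · rintro H' - hE ⟨φ, -, f, hf⟩
    have hadj : ∀ (i : Fin 2) (j : Fin (t + 1)), G.Adj (φ (Sum.inl i)) (φ (Sum.inr j)) := by
      intro i j
      have he : s(Sum.inl i, Sum.inr j) ∈ (K2 (t + 1)).edgeSet := by simp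
      obtain ⟨c, hc, hc'⟩ := hE (f ⟨_, he⟩).2
      have h1 := hf ⟨_, he⟩ (Sum.inl i) (by simp)
      have h2 := hf ⟨_, he⟩ (Sum.inr j) (by simp)
      rw [← hc'] at h1 h2
      exact (SimpleGraph.mem_cliqueFinset_iff.1 hc).isClique h1 h2 (by simp)
    have h := hG (φ (Sum.inl 0)) (φ (Sum.inl 1)) (by simp)
    have : (Finset.univ.map ⟨fun j : Fin (t + 1) => φ (Sum.inr j),
        φ.injective.comp Sum.inr_injective⟩).card ≤ t := by
      refine (Finset.card_le_card fun w hw => ?_).trans h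
      simp only [Finset.mem_map, Finset.mem_univ, true_and, Function.Embedding.coeFn_mk] at hw
      obtain ⟨j, rfl⟩ := hw
      simp [hadj]
    simp at this
  · change Set.ncard (_ '' _) = _
    rw [Set.ncard_image_of_injective _ Finset.coe_injective, Set.ncard_coe_finset]

end Berge

open Classical in
/-- The number of hyperedges of a Berge-`K_{2,t+1}`-free hypergraph is controlled by the number
of edges of a graph with codegrees at most `t`. -/
lemma BergeFree.exists_graph {n r t : ℕ} {H : Hypergraph (Fin n)} (hV : H.vertexSet = Set.univ)
    (hr : IsUniform r H) (hH : BergeFree (K2 (t + 1)) H) : ∃ G : SimpleGraph (Fin n),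
      CodegreeLE G t ∧ r * (r - 1) * H.edgeSet.ncard ≤
        max (r * (r - 1)) (2 * t.choose (r - 2)) * G.edgeFinset.card := by
  let N : H.edgeSet → Finset (Sym2 (Fin n)) := fun e =>
    Finset.univ.filter fun p => ¬ p.IsDiag ∧ ∀ x ∈ p, x ∈ (e : Set (Fin n))
  obtain ⟨S, f, g, hf, hf', hg, hg'⟩ := exists_matching_partition N
  let R := S.biUnion N
  let B := Finset.univ.image f
  have hRd : ∀ p ∈ R, ¬ p.IsDiag := by
    intro p hp
    obtain ⟨e, -, he⟩ := Finset.mem_biUnion.1 hp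
    exact (Finset.mem_filter.1 he).2.1
  have hBd : ∀ p ∈ B, ¬ p.IsDiag := by
    intro p hp
    obtain ⟨a, -, rfl⟩ := Finset.mem_image.1 hp
    exact (Finset.mem_filter.1 (hf' a).1).2.1
  have hRB : Disjoint R B := by
    rw [Finset.disjoint_right]
    intro p hp
    obtain ⟨a, -, rfl⟩ := Finset.mem_image.1 hp
    exact (hf' a).2
  have hBc : B.card = Fintype.card {a // a ∉ S} := Finset.card_image_of_injective _ hf
  -- `R` holds the red pairs, inside members of `S`; `B` the blue pairs, chosen for hyperedges
  -- outside `S`. `G` has both colours, `G'` only red.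
  obtain ⟨G, hGdef⟩ : ∃ G, G = SimpleGraph.fromEdgeSet ((R ∪ B : Finset _) : Set (Sym2 (Fin n))) :=
    ⟨_, rfl⟩
  obtain ⟨G', hG'def⟩ : ∃ G, G = SimpleGraph.fromEdgeSet (R : Set (Sym2 (Fin n))) := ⟨_, rfl⟩
  have hGe : G.edgeFinset = R ∪ B := by
    ext p
    rw [SimpleGraph.mem_edgeFinset, hGdef, SimpleGraph.edgeSet_fromEdgeSet]
    simp only [Set.mem_sdiff, Finset.mem_coe, Finset.mem_union]
    refine ⟨fun h => h.1, fun h => ⟨h, ?_⟩⟩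
    rcases h with h | h
    · exact hRd p h
    · exact hBd p h
  have hG'e : G'.edgeFinset = R := by
    ext p
    rw [SimpleGraph.mem_edgeFinset, hG'def, SimpleGraph.edgeSet_fromEdgeSet]
    exact ⟨fun h => h.1, fun h => ⟨h, hRd p h⟩⟩
  have hmemB (e : G.edgeSet) (he : (e : Sym2 (Fin n)) ∉ R) : ∃ a, f a = e := by
    have := (hGe ▸ SimpleGraph.mem_edgeFinset.2 e.2 : (e : Sym2 (Fin n)) ∈ R ∪ B)
    rcases Finset.mem_union.1 this with h | h
    · exact absurd h he
    · obtain ⟨a, -, ha⟩ := Finset.mem_image.1 h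
      exact ⟨a, ha⟩
  let F : G.edgeSet → H.edgeSet := fun e =>
    if he : (e : Sym2 (Fin n)) ∈ R then g ⟨e, he⟩ else (hmemB e he).choose
  -- Red edges go into `S` and blue edges outside it, so the two matchings cannot collide.
  have hFinj : Function.Injective F := by
    intro e e' h
    simp only [F] at h
    split_ifs at h with h1 h2 h2
    · exact Subtype.ext (Subtype.mk.inj (hg h))
    · exact absurd (h ▸ (hg' ⟨e, h1⟩).1) (hmemB e' h2).choose.2
    · exact absurd (h ▸ (hg' ⟨e', h2⟩).1) (hmemB e h1).choose.2
    · apply Subtype.ext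
      rw [← (hmemB e h1).choose_spec, ← (hmemB e' h2).choose_spec, Subtype.ext h]
  have hFmem : ∀ e : G.edgeSet, ∀ x ∈ (e : Sym2 (Fin n)), x ∈ (F e : Set (Fin n)) := by
    intro e x hx
    simp only [F]
    split_ifs with h1
    · exact (Finset.mem_filter.1 (hg' ⟨e, h1⟩).2).2.2 x hx
    · have := (hf' (hmemB e h1).choose).1
      rw [(hmemB e h1).choose_spec] at this
      exact (Finset.mem_filter.1 this).2.2 x hx
  have hG : CodegreeLE G t := hH.codegreeLE hV G F hFinj hFmem
  have hle : ∀ {u v}, G'.Adj u v → G.Adj u v := by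
    intro u v h
    rw [hG'def, SimpleGraph.fromEdgeSet_adj] at h
    rw [hGdef, SimpleGraph.fromEdgeSet_adj]
    exact ⟨Finset.mem_coe.2 (Finset.mem_union_left _ h.1), h.2⟩
  have hG' : CodegreeLE G' t := fun u v huv => by
    refine (Finset.card_le_card fun w hw => ?_).trans (hG u v huv)
    simp only [Finset.mem_filter] at hw ⊢
    exact ⟨hw.1, hle hw.2.1, hle hw.2.2⟩
  have hS : S.card ≤ (G'.cliqueFinset r).card := by
    refine Finset.card_le_card_of_injOn (fun e => (e : Set (Fin n)).toFinset) (fun e he => ?_) ?_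
    · rw [Finset.mem_coe, SimpleGraph.mem_cliqueFinset_iff, SimpleGraph.isNClique_iff]
      refine ⟨fun x hx y hy hxy => ?_, ?_⟩
      · rw [Set.coe_toFinset] at hx hy
        rw [hG'def, SimpleGraph.fromEdgeSet_adj]
        refine ⟨Finset.mem_coe.2 (Finset.mem_biUnion.2 ⟨e, he, ?_⟩), hxy⟩
        simp [N, hx, hy, hxy]
      · rw [← hr e e.2, Set.ncard_eq_toFinset_card']
    · intro e _ e' _ h
      exact Subtype.ext (Set.toFinset_inj.1 h)
  have hcard : H.edgeSet.ncard = S.card + B.card := by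
    rw [hBc, ← Nat.card_coe_set_eq, Nat.card_eq_fintype_card, Fintype.card_subtype_compl,
      Fintype.card_coe, Nat.add_sub_cancel' (Finset.card_le_univ S)]
  have hcl : r * (r - 1) * (G'.cliqueFinset r).card ≤ 2 * R.card * t.choose (r - 2) := by
    have := mul_card_cliqueFinset_le G' hG' r
    convert this
    exact hG'e.symm
  refine ⟨G, hG, ?_⟩
  rw [hGe, Finset.card_union_of_disjoint hRB, hcard, mul_add, mul_add]
  refine Nat.add_le_add ?_ (Nat.mul_le_mul_right _ (le_max_left _ _))
  refine (Nat.mul_le_mul_left _ hS).trans (hcl.trans ?_)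
  rw [mul_right_comm]
  exact Nat.mul_le_mul_right _ (le_max_right _ _)

/-! ### Asymptotic upper bounds. -/

lemma rpow_three_halves_sq (n : ℕ) : ((n : ℝ) ^ (3 / 2 : ℝ)) ^ 2 = (n : ℝ) ^ 3 := by
  rw [← Real.rpow_natCast, ← Real.rpow_mul (Nat.cast_nonneg n), ← Real.rpow_natCast]
  norm_num

/-- With `x = 2e` the count reads `x² ≤ n x + s²`, which forces `x ≤ n + s`. -/
lemma two_mul_card_edgeFinset_le {n t : ℕ} (G : SimpleGraph (Fin n)) [DecidableRel G.Adj]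
    (hG : CodegreeLE G t) :
    2 * (G.edgeFinset.card : ℝ) ≤ n + Real.sqrt t * (n : ℝ) ^ (3 / 2 : ℝ) := by
  have h := sq_two_mul_card_edgeFinset_le G hG
  rw [Fintype.card_fin] at h
  have h' : (2 * (G.edgeFinset.card : ℝ)) ^ 2 ≤ n * (2 * (G.edgeFinset.card : ℝ) + t * n ^ 2) := by
    exact_mod_cast h
  generalize 2 * (G.edgeFinset.card : ℝ) = x at h'
  have hs : (Real.sqrt t * (n : ℝ) ^ (3 / 2 : ℝ)) ^ 2 = t * n ^ 3 := by
    rw [mul_pow, rpow_three_halves_sq, Real.sq_sqrt (Nat.cast_nonneg t)]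
  have hs0 : 0 ≤ Real.sqrt t * (n : ℝ) ^ (3 / 2 : ℝ) := by positivity
  generalize Real.sqrt t * (n : ℝ) ^ (3 / 2 : ℝ) = s at *
  have hn : (0 : ℝ) ≤ n := Nat.cast_nonneg n
  by_contra! hlt
  nlinarith

/-- An upper bound for the Turán number of Berge-`K_{2,t+1}`. -/
lemma mul_bergeEx_le (n r t : ℕ) :
    ((r * (r - 1) : ℕ) : ℝ) * bergeEx r n (K2 (t + 1)) ≤
      ((max (r * (r - 1)) (2 * t.choose (r - 2)) : ℕ) : ℝ) *
        ((n + Real.sqrt t * (n : ℝ) ^ (3 / 2 : ℝ)) / 2) := by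
  classical
  obtain ⟨H, hV, hr, hH, hm⟩ := (isGreatest_bergeEx r n (K2 (t + 1))
    ⟨s(Sum.inl 0, Sum.inr 0), by simp⟩).1
  obtain ⟨G, hG, hle⟩ := hH.exists_graph hV hr
  rw [hm] at hle
  have h1 := two_mul_card_edgeFinset_le G hG
  calc _ ≤ ((max (r * (r - 1)) (2 * t.choose (r - 2)) : ℕ) : ℝ) * G.edgeFinset.card := by
        exact_mod_cast hle
    _ ≤ _ := by
        gcongr
        linarith

/-- Covers `r = 1`, where `mul_bergeEx_le` is void because its factor `r(r-1)` vanishes. -/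
lemma bergeEx_one_le {W : Type*} (n : ℕ) (F : SimpleGraph W) : bergeEx 1 n F ≤ n := by
  refine csSup_le' ?_
  rintro m ⟨H, -, hr, -, rfl⟩
  have : H.edgeSet ⊆ Set.range (fun x : Fin n => ({x} : Set (Fin n))) := fun e he => by
    obtain ⟨x, rfl⟩ := Set.ncard_eq_one.1 (hr e he)
    exact ⟨x, rfl⟩
  calc H.edgeSet.ncard ≤ (Set.range (fun x : Fin n => ({x} : Set (Fin n)))).ncard :=
        Set.ncard_le_ncard this
    _ ≤ n := by
        rw [← Set.image_univ]
        refine (Set.ncard_image_le).trans ?_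
        simp

/-- Turns an upper bound with a linear error term into one with a `1 + o(1)` factor. -/
lemma exists_tendsto_of_le {f : ℕ → ℝ} {c C : ℝ} (hc : 0 < c)
    (h : ∀ n : ℕ, f n ≤ c * (n : ℝ) ^ (3 / 2 : ℝ) + C * n) :
    ∃ ε : ℕ → ℝ, Tendsto ε atTop (𝓝 0) ∧ ∀ n : ℕ, f n ≤ (1 + ε n) * c * (n : ℝ) ^ (3 / 2 : ℝ) := by
  refine ⟨fun n => C / c * (n : ℝ) ^ (-(1 / 2) : ℝ), ?_, fun n => (h n).trans (le_of_eq ?_)⟩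
  · have := (tendsto_rpow_neg_atTop (y := 1 / 2) (by norm_num)).comp tendsto_natCast_atTop_atTop
    simpa using this.const_mul (C / c)
  · rcases Nat.eq_zero_or_pos n with rfl | hn
    · simp
    · have hn' : (0 : ℝ) < n := Nat.cast_pos.2 hn
      have : (n : ℝ) = (n : ℝ) ^ (-(1 / 2) : ℝ) * (n : ℝ) ^ (3 / 2 : ℝ) := by
        rw [← Real.rpow_add hn']; norm_num
      calc c * (n : ℝ) ^ (3 / 2 : ℝ) + C * n
          = c * (n : ℝ) ^ (3 / 2 : ℝ) + C * ((n : ℝ) ^ (-(1 / 2) : ℝ) * (n : ℝ) ^ (3 / 2 : ℝ)) := by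
            rw [← this]
        _ = _ := by field_simp

theorem bergeEx_le_of_lt {r t : ℕ} (hr : 1 ≤ r) (ht : r + 1 ≤ t) :
    ∃ ε : ℕ → ℝ, Tendsto ε atTop (𝓝 0) ∧ ∀ n : ℕ, (bergeEx r n (K2 t) : ℝ) ≤
      (1 + ε n) * (Real.sqrt ((t : ℝ) - 1) * (t.choose (r - 1) : ℝ) / ((r : ℝ) * (t : ℝ))) *
        (n : ℝ) ^ (3 / 2 : ℝ) := by
  have ht1 : (1 : ℝ) < t := by exact_mod_cast (by omega : 1 < t)
  have hr0 : (0 : ℝ) < r := by exact_mod_cast hr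
  have hch : (0 : ℝ) < t.choose (r - 1) := by
    exact_mod_cast Nat.choose_pos (by omega)
  have hsq : 0 < Real.sqrt ((t : ℝ) - 1) := Real.sqrt_pos.2 (by linarith)
  have hc : 0 < Real.sqrt ((t : ℝ) - 1) * (t.choose (r - 1) : ℝ) / ((r : ℝ) * (t : ℝ)) := by
    positivity
  rcases Nat.eq_or_lt_of_le hr with rfl | hr2
  · refine exists_tendsto_of_le (C := 1) hc fun n => ?_
    have h1 : (bergeEx 1 n (K2 t) : ℝ) ≤ n := by exact_mod_cast bergeEx_one_le n (K2 t)
    have : 0 ≤ Real.sqrt ((t : ℝ) - 1) * (t.choose (1 - 1) : ℝ) / (((1 : ℕ) : ℝ) * (t : ℝ)) *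
      (n : ℝ) ^ (3 / 2 : ℝ) := by positivity
    linarith
  · obtain ⟨s, rfl⟩ : ∃ s, t = s + 1 := ⟨t - 1, by omega⟩
    obtain ⟨q, rfl⟩ : ∃ q, r = q + 2 := ⟨r - 2, by omega⟩
    have e1 : q + 2 - 1 = q + 1 := rfl
    have e2 : q + 2 - 2 = q := rfl
    -- Red weight dominates: `t - 1 ≥ r` gives `2C(t-1, r-2) ≥ 2C(r, r-2) = r(r-1)`.
    have hmax : max ((q + 2) * (q + 1)) (2 * s.choose q) = 2 * s.choose q := by
      refine max_eq_right ?_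
      have h1 : (q + 2).choose q ≤ s.choose q := Nat.choose_le_choose q (by omega)
      have h2 : (q + 2).choose q * 2 = (q + 2) * (q + 1) := by
        rw [Nat.choose_symm_add, Nat.choose_two_right, Nat.div_mul_cancel]
        · rfl
        · exact (Nat.even_mul_pred_self _).two_dvd
      omega
    have hsucc : (((s + 1).choose (q + 1) : ℕ) : ℝ) * (q + 1) = (s + 1) * s.choose q := by
      exact_mod_cast (Nat.add_one_mul_choose_eq s q).symm
    refine exists_tendsto_of_le (C := s.choose q / ((q + 2) * (q + 1))) hc fun n => ?_
    have h := mul_bergeEx_le n (q + 2) s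
    rw [e1, e2, hmax] at h
    push_cast at h ⊢
    rw [add_sub_cancel_right]
    have e3 : (((s + 1).choose (q + 1) : ℕ) : ℝ) = (s + 1) * s.choose q / (q + 1) := by
      rw [← hsucc]; field_simp
    rw [e3]
    have hq : (0 : ℝ) < (q + 2) * (q + 1) := by positivity
    refine le_of_mul_le_mul_left (h.trans (le_of_eq ?_)) hq
    field_simp
    ring

theorem bergeEx_le_of_ge {r t : ℕ} (ht : 2 ≤ t) (hr : t ≤ r) :
    ∃ ε : ℕ → ℝ, Tendsto ε atTop (𝓝 0) ∧ ∀ n : ℕ, (bergeEx r n (K2 t) : ℝ) ≤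
      (1 + ε n) * (Real.sqrt ((t : ℝ) - 1) / 2) * (n : ℝ) ^ (3 / 2 : ℝ) := by
  obtain ⟨s, rfl⟩ : ∃ s, t = s + 1 := ⟨t - 1, by omega⟩
  obtain ⟨q, rfl⟩ : ∃ q, r = q + 2 := ⟨r - 2, by omega⟩
  have hs : (0 : ℝ) < s := by exact_mod_cast (by omega : 0 < s)
  have e1 : q + 2 - 1 = q + 1 := rfl
  have e2 : q + 2 - 2 = q := rfl
  -- Blue weight dominates: `C(t-1, r-2) ≤ C(r-1, r-2) = r - 1` and `2 ≤ r`.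
  have hmax : max ((q + 2) * (q + 1)) (2 * s.choose q) = (q + 2) * (q + 1) := by
    refine max_eq_left ?_
    have h1 : s.choose q ≤ (q + 1).choose q := Nat.choose_le_choose q (by omega)
    rw [Nat.choose_succ_self_right] at h1
    exact Nat.mul_le_mul (by omega) h1
  push_cast
  rw [add_sub_cancel_right]
  refine exists_tendsto_of_le (C := 1 / 2) (by positivity) fun n => ?_
  have h := mul_bergeEx_le n (q + 2) s
  rw [e1, e2, hmax] at h
  have hq : (0 : ℝ) < ((q + 2) * (q + 1) : ℕ) := by positivity
  refine (le_of_mul_le_mul_left h hq).trans (le_of_eq ?_)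
  ring

/-! ### An algebraic `K_{2,k+1}`-free graph with many triangles. -/

section Construction

variable (F : Type*) [Field F] (k : ℕ)

/-- The group of nonzero `k`-th powers. -/
abbrev PowGroup : Subgroup Fˣ := (powMonoidHom k : Fˣ →* Fˣ).range

/-- The graph on pairs of an element and a nonzero `k`-th power in which `(a, b)` and `(x, y)` are
adjacent when `b * y = (a + x) ^ k`. -/
def powGraph : SimpleGraph (F × PowGroup F k) where
  Adj u v := u ≠ v ∧ ((u.2 : Fˣ) : F) * ((v.2 : Fˣ) : F) = (u.1 + v.1) ^ k
  symm := ⟨fun u v h => ⟨h.1.symm, by rw [mul_comm, h.2, add_comm]⟩⟩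
  loopless := ⟨fun _ h => h.1 rfl⟩

variable {F k}

lemma powGraph_adj {u v : F × PowGroup F k} : (powGraph F k).Adj u v ↔
    u ≠ v ∧ ((u.2 : Fˣ) : F) * ((v.2 : Fˣ) : F) = (u.1 + v.1) ^ k := Iff.rfl

/-- Dividing the two adjacency equations eliminates `y`: a common neighbour gives a `k`-th root of
`b / b'`. -/
lemma ratio_mem_filter {a a' x : F} {b b' y : PowGroup F k} (hk0 : k ≠ 0)
    (h : ((b : Fˣ) : F) * ((y : Fˣ) : F) = (a + x) ^ k)
    (h' : ((b' : Fˣ) : F) * ((y : Fˣ) : F) = (a' + x) ^ k) :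
    a + x ≠ 0 ∧ a' + x ≠ 0 ∧ ((a + x) / (a' + x)) ^ k = (((b / b' : PowGroup F k) : Fˣ) : F) := by
  have hne : ∀ {a : F} {b : PowGroup F k}, ((b : Fˣ) : F) * ((y : Fˣ) : F) = (a + x) ^ k →
      a + x ≠ 0 := by
    intro a b h h0
    rw [h0, zero_pow hk0] at h
    exact mul_ne_zero (Units.ne_zero _) (Units.ne_zero _) h
  refine ⟨hne h, hne h', ?_⟩
  rw [div_pow, ← h, ← h', mul_div_mul_right _ _ (Units.ne_zero _)]
  simp

lemma coe_powGroup_injective : Function.Injective fun b : PowGroup F k => ((b : Fˣ) : F) :=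
  Units.val_injective.comp Subtype.val_injective

lemma exists_powGroup_mul_eq {s : F} (hs : s ≠ 0) (b : PowGroup F k) :
    ∃ y : PowGroup F k, ((b : Fˣ) : F) * ((y : Fˣ) : F) = s ^ k := by
  refine ⟨⟨(Units.mk0 s hs) ^ k, ⟨_, rfl⟩⟩ * b⁻¹, ?_⟩
  have := (b : Fˣ).ne_zero
  simp only [Subgroup.coe_mul, InvMemClass.coe_inv, Units.val_mul, Units.val_pow_eq_pow_val,
    Units.val_mk0, Units.val_inv_eq_inv_val]
  field_simp

variable [Fintype F] [DecidableEq F]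

/-- The unit group is cyclic, so the fibres of the `k`-th power map over its range have the size of
its kernel, `gcd(q - 1, k) = k`. -/
lemma card_filter_pow_eq (hk : k ∣ Fintype.card F - 1) (d : PowGroup F k) :
    (Finset.univ.filter fun c : F => c ^ k = ((d : Fˣ) : F)).card = k := by
  have hk0 : k ≠ 0 := by
    rintro rfl
    have := Fintype.one_lt_card (α := F)
    have := Nat.eq_zero_of_zero_dvd hk
    omega
  have h1 : (Finset.univ.filter fun c : F => c ^ k = ((d : Fˣ) : F)) =
      (Finset.univ.filter fun c : Fˣ => powMonoidHom k c = (d : Fˣ)).map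
        ⟨fun c : Fˣ => (c : F), Units.val_injective⟩ := by
    ext c
    simp only [Finset.mem_filter, Finset.mem_univ, true_and, Finset.mem_map,
      Function.Embedding.coeFn_mk, powMonoidHom_apply]
    constructor
    · intro h
      have hc : c ≠ 0 := by
        rintro rfl
        rw [zero_pow hk0] at h
        exact (d : Fˣ).ne_zero h.symm
      exact ⟨Units.mk0 c hc, Units.ext (by simpa using h), rfl⟩
    · rintro ⟨c, hc, rfl⟩
      rw [← hc, Units.val_pow_eq_pow_val]
  rw [h1, Finset.card_map, MonoidHom.card_fiber_eq_of_mem_range (powMonoidHom k : Fˣ →* Fˣ)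
    (x := (d : Fˣ)) (y := 1) d.2 ⟨1, map_one _⟩]
  have h2 := IsCyclic.card_powMonoidHom_ker Fˣ k
  rw [Nat.card_eq_fintype_card (α := Fˣ), Fintype.card_units, Nat.gcd_eq_right hk] at h2
  refine Eq.trans ?_ h2
  rw [← Fintype.card_subtype, ← Nat.card_eq_fintype_card]
  rfl

lemma card_powGroup_mul (hk : k ∣ Fintype.card F - 1) :
    Fintype.card (PowGroup F k) * k = Fintype.card F - 1 := by
  have h := IsCyclic.card_powMonoidHom_range Fˣ k
  rw [Nat.card_eq_fintype_card (α := Fˣ), Fintype.card_units, Nat.gcd_eq_right hk,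
    Nat.card_eq_fintype_card] at h
  rw [h, Nat.div_mul_cancel hk]

open Classical in
-- The root `(a + x)/(a' + x)` determines `x` when `a ≠ a'`, and then `y`. If `a = a'`, a common
-- neighbour would force `b = b'`.
lemma codegreeLE_powGraph (hk : k ∣ Fintype.card F - 1) (hk0 : k ≠ 0) :
    CodegreeLE (powGraph F k) k := by
  rintro ⟨a, b⟩ ⟨a', b'⟩ huv
  refine (Finset.card_le_card_of_injOn (fun w => (a + w.1) / (a' + w.1)) ?_ ?_).trans_eq
    (card_filter_pow_eq hk (b / b'))
  · rintro ⟨x, y⟩ hw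
    simp only [Finset.coe_filter, Set.mem_ofPred_eq, powGraph_adj] at hw
    simpa using (ratio_mem_filter hk0 hw.2.1.2 hw.2.2.2).2.2
  · rintro ⟨x, y⟩ hw ⟨x', y'⟩ hw' h
    simp only [Finset.coe_filter, Set.mem_ofPred_eq, powGraph_adj] at hw hw' h
    obtain ⟨h1, h2, -⟩ := ratio_mem_filter hk0 hw.2.1.2 hw.2.2.2
    obtain ⟨h3, h4, -⟩ := ratio_mem_filter hk0 hw'.2.1.2 hw'.2.2.2
    rw [div_eq_div_iff h2 h4] at h
    have h5 : (a - a') * (x' - x) = 0 := by linear_combination h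
    have hx : x = x' := by
      rcases mul_eq_zero.1 h5 with h6 | h6
      · have haa : a = a' := sub_eq_zero.1 h6
        subst haa
        refine absurd (show (a, b) = (a, b') from Prod.ext rfl (coe_powGroup_injective ?_)) huv
        exact mul_right_cancel₀ (Units.ne_zero (y : Fˣ)) (hw.2.1.2.trans hw.2.2.2.symm)
      · exact (sub_eq_zero.1 h6).symm
    subst hx
    refine Prod.ext rfl (coe_powGroup_injective ?_)
    exact mul_left_cancel₀ (Units.ne_zero (b : Fˣ)) (hw.2.1.2.trans hw'.2.1.2.symm)

/-- The vertex `u` is not a loop of the relation defining `powGraph`. -/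
def NoLoop (u : F × PowGroup F k) : Prop :=
  ((u.2 : Fˣ) : F) * ((u.2 : Fˣ) : F) ≠ (u.1 + u.1) ^ k

open Classical in
-- Conversely each root `c` of `b / b'` comes from a common neighbour: `b ≠ b'` gives `c ≠ 1`, so `c
-- = (a + x)/(a' + x)` can be solved for `x`. `NoLoop` keeps the solution distinct from `u` and `v`.
lemma le_card_commonNeighbors_powGraph (hk : k ∣ Fintype.card F - 1) {u v : F × PowGroup F k}
    (hu : NoLoop u) (hv : NoLoop v) (h1 : u.1 ≠ v.1) (h2 : u.2 ≠ v.2) :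
    k ≤ (Finset.univ.filter fun w => (powGraph F k).Adj u w ∧ (powGraph F k).Adj v w).card := by
  obtain ⟨a, b⟩ := u
  obtain ⟨a', b'⟩ := v
  simp only at h1 h2
  refine (card_filter_pow_eq hk (b / b')).ge.trans
    (Finset.card_le_card_of_surjOn (fun w => (a + w.1) / (a' + w.1)) ?_)
  intro c hc
  have hc : c ^ k = (((b / b' : PowGroup F k) : Fˣ) : F) := by simpa using hc
  have hck : ((b' : Fˣ) : F) * c ^ k = ((b : Fˣ) : F) := by
    have := (b' : Fˣ).ne_zero
    rw [hc, Subgroup.coe_div, Units.val_div_eq_div_val, mul_div_cancel₀ _ this]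
  have hc1 : 1 - c ≠ 0 := by
    intro h
    rw [← sub_eq_zero.1 h, one_pow, mul_one] at hck
    exact h2 (coe_powGroup_injective hck.symm)
  have hk0 : k ≠ 0 := by
    rintro rfl
    rw [pow_zero, mul_one] at hck
    exact h2 (coe_powGroup_injective hck.symm)
  have hc0 : c ≠ 0 := by
    rintro rfl
    rw [zero_pow hk0, mul_zero] at hck
    exact Units.ne_zero _ hck.symm
  have haa : a' - a ≠ 0 := sub_ne_zero.2 (Ne.symm h1)
  set x := (c * a' - a) / (1 - c) with hx
  have e1 : a' + x = (a' - a) / (1 - c) := by rw [hx]; field_simp; ring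
  have e2 : a + x = c * (a' + x) := by rw [e1, hx]; field_simp; ring
  have e3 : a' + x ≠ 0 := by rw [e1]; exact div_ne_zero haa hc1
  clear_value x
  obtain ⟨y, hy⟩ := exists_powGroup_mul_eq e3 b'
  have hy' : ((b : Fˣ) : F) * ((y : Fˣ) : F) = (a + x) ^ k := by
    rw [e2, mul_pow, ← hy, ← hck]; ring
  refine ⟨(x, y), ?_, ?_⟩
  · simp only [Finset.coe_filter, Finset.mem_univ, true_and, Set.mem_ofPred_eq, powGraph_adj]
    refine ⟨⟨?_, hy'⟩, ?_, hy⟩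
    · intro h
      rw [Prod.mk.injEq] at h
      obtain ⟨rfl, rfl⟩ := h
      exact hu hy'
    · intro h
      rw [Prod.mk.injEq] at h
      obtain ⟨rfl, rfl⟩ := h
      exact hv hy
  · simp only
    rw [e2, mul_div_cancel_right₀ _ e3]

open Classical in
lemma card_filter_sq_mul_eq_le_two {c d : F} (hd : d ≠ 0) :
    (Finset.univ.filter fun b : PowGroup F k => ((b : Fˣ) : F) * ((b : Fˣ) : F) * c = d).card ≤ 2 := by
  rcases Finset.eq_empty_or_nonempty (Finset.univ.filter fun b : PowGroup F k =>
    ((b : Fˣ) : F) * ((b : Fˣ) : F) * c = d) with h | ⟨b₀, hb₀⟩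
  · rw [h]; simp
  · refine (Finset.card_le_card_of_injOn (t := {((b₀ : Fˣ) : F), -((b₀ : Fˣ) : F)})
      (fun b : PowGroup F k => ((b : Fˣ) : F)) ?_ coe_powGroup_injective.injOn).trans
      Finset.card_le_two
    intro b hb
    simp only [Finset.coe_filter, Finset.mem_filter, Finset.mem_univ, true_and,
      Set.mem_ofPred_eq] at hb hb₀
    have hc : c ≠ 0 := by
      rintro rfl
      exact hd (by rw [← hb, mul_zero])
    have := mul_right_cancel₀ hc (hb.trans hb₀.symm)
    simpa using mul_self_eq_mul_self_iff.1 this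

open Classical in
-- Each pair in `GP` has at least `k` common neighbours, hence lies in `k` triangles, and a triangle
-- contains six ordered pairs. For fixed `a`, two values of `a'` are lost, then at most six of `b`.
lemma mul_le_six_mul_card_cliqueFinset_powGraph (hk : k ∣ Fintype.card F - 1) :
    k * (Fintype.card F * (Fintype.card F - 2) * (Fintype.card (PowGroup F k) - 6)) ≤
      6 * ((powGraph F k).cliqueFinset 3).card := by
  set G := powGraph F k
  set GP := Finset.univ.filter fun p : (F × PowGroup F k) × (F × PowGroup F k) =>
    G.Adj p.1 p.2 ∧ NoLoop p.1 ∧ NoLoop p.2 ∧ p.1.1 ≠ p.2.1 ∧ p.1.2 ≠ p.2.2 with hGP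
  -- A triple `(a, a', b)` determines the neighbour `(a', y)`. The last three conditions say that
  -- `(a, b)` is no loop, that `b ≠ y`, and, after multiplication by `b²`, that `(a', y)` is no
  -- loop.
  set T := Finset.univ.filter fun p : F × F × PowGroup F k =>
    (p.1 + p.2.1 ≠ 0 ∧ p.1 ≠ p.2.1) ∧
      ((p.2.2 : Fˣ) : F) * ((p.2.2 : Fˣ) : F) ≠ (p.1 + p.1) ^ k ∧
      ((p.2.2 : Fˣ) : F) * ((p.2.2 : Fˣ) : F) ≠ (p.1 + p.2.1) ^ k ∧
      ((p.2.2 : Fˣ) : F) * ((p.2.2 : Fˣ) : F) * (p.2.1 + p.2.1) ^ k ≠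
        (p.1 + p.2.1) ^ k * (p.1 + p.2.1) ^ k with hT
  have hTGP : T.card ≤ GP.card := by
    refine Finset.card_le_card_of_surjOn (fun p => (p.1.1, p.2.1, p.1.2)) ?_
    rintro ⟨a, a', b⟩ h
    simp only [hT, Finset.coe_filter, Finset.mem_univ, true_and, Set.mem_ofPred_eq] at h
    obtain ⟨⟨h1, h2⟩, h3, h4, h5⟩ := h
    obtain ⟨y, hy⟩ := exists_powGroup_mul_eq h1 b
    refine ⟨((a, b), (a', y)), ?_, rfl⟩
    simp only [hGP, Finset.coe_filter, Finset.mem_univ, true_and, Set.mem_ofPred_eq]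
    refine ⟨⟨fun h => h2 (congrArg Prod.fst h), hy⟩, h3, fun h => h5 ?_, h2, ?_⟩
    · rw [← hy, ← h]
      ring
    · rintro rfl
      exact h4 hy
  have hTc : Fintype.card F * (Fintype.card F - 2) * (Fintype.card (PowGroup F k) - 6) ≤ T.card := by
    rw [hT, Finset.card_filter, Fintype.sum_prod_type, mul_assoc, ← smul_eq_mul, ← Finset.card_univ,
      ← Finset.sum_const]
    refine Finset.sum_le_sum fun a _ => ?_
    rw [Fintype.sum_prod_type]
    have hA : Fintype.card F - 2 ≤ (Finset.univ \ {-a, a} : Finset F).card := by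
      rw [Finset.card_sdiff_of_subset (Finset.subset_univ _), Finset.card_univ]
      exact Nat.sub_le_sub_left Finset.card_le_two _
    refine (Nat.mul_le_mul_right _ hA).trans ?_
    rw [← smul_eq_mul, ← Finset.sum_const]
    refine (Finset.sum_le_sum fun a' ha' => ?_).trans
      (Finset.sum_le_sum_of_subset (Finset.subset_univ _))
    have ha : a + a' ≠ 0 ∧ a ≠ a' := by
      simp only [Finset.mem_sdiff, Finset.mem_univ, true_and, Finset.mem_insert,
        Finset.mem_singleton, not_or] at ha'
      exact ⟨fun h => ha'.1 (eq_neg_of_add_eq_zero_right h), Ne.symm ha'.2⟩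
    rw [← Finset.card_filter]
    simp only [ha, ne_eq, not_false_eq_true, true_and, and_self]
    set S₁ := Finset.univ.filter fun b : PowGroup F k =>
      ((b : Fˣ) : F) * ((b : Fˣ) : F) * 1 = (a + a) ^ k
    set S₂ := Finset.univ.filter fun b : PowGroup F k =>
      ((b : Fˣ) : F) * ((b : Fˣ) : F) * 1 = (a + a') ^ k
    set S₃ := Finset.univ.filter fun b : PowGroup F k =>
      ((b : Fˣ) : F) * ((b : Fˣ) : F) * (a' + a') ^ k = (a + a') ^ k * (a + a') ^ k
    have hpow : (a + a') ^ k ≠ 0 := pow_ne_zero k ha.1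
    have h₁ : S₁.card ≤ 2 := by
      by_cases h0 : (a + a) ^ k = 0
      · simp [S₁, h0]
      · exact card_filter_sq_mul_eq_le_two h0
    have h₂ : S₂.card ≤ 2 := card_filter_sq_mul_eq_le_two hpow
    have h₃ : S₃.card ≤ 2 := card_filter_sq_mul_eq_le_two (mul_ne_zero hpow hpow)
    have hu : (S₁ ∪ S₂ ∪ S₃).card ≤ 6 :=
      (Finset.card_union_le _ _).trans (by have := Finset.card_union_le S₁ S₂; omega)
    calc Fintype.card (PowGroup F k) - 6 ≤ (Finset.univ \ (S₁ ∪ S₂ ∪ S₃)).card := by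
          rw [Finset.card_sdiff_of_subset (Finset.subset_univ _), Finset.card_univ]
          exact Nat.sub_le_sub_left hu _
      _ ≤ _ := by
          refine Finset.card_le_card fun b hb => ?_
          simp only [S₁, S₂, S₃, Finset.mem_sdiff, Finset.mem_union, Finset.mem_filter,
            Finset.mem_univ, true_and, mul_one, not_or] at hb ⊢
          exact ⟨hb.1.1, hb.1.2, hb.2⟩
  have hsum := mul_card_cliqueFinset_eq_sum G 3
  calc _ ≤ k * GP.card := Nat.mul_le_mul_left _ (hTc.trans hTGP)
    _ = ∑ p ∈ GP, k := by rw [Finset.sum_const, smul_eq_mul, mul_comm]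
    _ ≤ ∑ p ∈ GP, ((G.cliqueFinset 3).filter fun c => p ∈ c.offDiag).card := by
        refine Finset.sum_le_sum fun p hp => ?_
        obtain ⟨-, hadj, hu, hv, h1, h2⟩ := Finset.mem_filter.1 hp
        refine (le_card_commonNeighbors_powGraph hk hu hv h1 h2).trans ?_
        refine Finset.card_le_card_of_injOn (fun w => {p.1, p.2, w}) ?_ ?_
        · intro w hw
          simp only [Finset.coe_filter, Finset.mem_univ, true_and, Set.mem_ofPred_eq] at hw
          simp only [Finset.coe_filter, Set.mem_ofPred_eq, SimpleGraph.mem_cliqueFinset_iff,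
            SimpleGraph.is3Clique_triple_iff, Finset.mem_offDiag, Finset.mem_insert,
            Finset.mem_singleton, true_or, or_true, true_and]
          exact ⟨⟨hadj, hw.1, hw.2⟩, hadj.ne⟩
        · intro w hw w' hw' h
          simp only [Finset.coe_filter, Finset.mem_univ, true_and, Set.mem_ofPred_eq] at hw hw'
          have : w ∈ ({p.1, p.2, w'} : Finset _) := by
            rw [← show ({p.1, p.2, w} : Finset _) = {p.1, p.2, w'} from h]
            simp
          simp only [Finset.mem_insert, Finset.mem_singleton] at this
          rcases this with h | h | h
          · exact absurd h.symm hw.1.ne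
          · exact absurd h.symm hw.2.ne
          · exact h
    _ ≤ ∑ p ∈ Finset.univ.filter (fun p : (F × PowGroup F k) × (F × PowGroup F k) =>
          G.Adj p.1 p.2), ((G.cliqueFinset 3).filter fun c => p ∈ c.offDiag).card := by
        refine Finset.sum_le_sum_of_subset fun p hp => ?_
        rw [Finset.mem_filter] at hp ⊢
        exact ⟨hp.1, hp.2.1⟩
    _ = _ := hsum.symm

end Construction

/-! ### The matching lower bound for `r = 3`. -/

open Classical in
-- Pad with isolated vertices. They create new cliques of size 1 only, whence `r ≠ 1`.
lemma card_cliqueFinset_le_bergeEx_of_card_le {V : Type*} [Fintype V] {n t r : ℕ} (hr : r ≠ 1)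
    (G : SimpleGraph V) (hG : CodegreeLE G t) (hn : Fintype.card V ≤ n) :
    (G.cliqueFinset r).card ≤ bergeEx r n (K2 (t + 1)) := by
  obtain ⟨e⟩ : Nonempty (V ↪ Fin n) := Function.Embedding.nonempty_of_card_le (by simpa using hn)
  have h : CodegreeLE (G.map e) t := by
    intro u v huv
    rcases Finset.eq_empty_or_nonempty
      (Finset.univ.filter fun w => (G.map e).Adj u w ∧ (G.map e).Adj v w) with h | ⟨w, hw⟩
    · rw [h]; simp
    · obtain ⟨-, ⟨-, u, _, _, rfl, rfl⟩, ⟨-, v, _, _, rfl, -⟩⟩ := Finset.mem_filter.1 hw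
      refine le_trans ?_ (hG u v (fun h => huv (congrArg e h)))
      rw [← Finset.card_map e]
      refine Finset.card_le_card fun w hw => ?_
      simp only [Finset.mem_filter, Finset.mem_univ, true_and, SimpleGraph.map_adj] at hw
      obtain ⟨⟨u', w', h1, hu, rfl⟩, ⟨v', w'', h2, hv, hw⟩⟩ := hw
      rw [e.injective hu] at h1
      rw [e.injective hv, e.injective hw] at h2
      simp [h1, h2]
  have := card_cliqueFinset_le_bergeEx (r := r) _ h
  rwa [SimpleGraph.cliqueFinset_map G e hr, Finset.card_map] at this

lemma le_six_mul_bergeEx_of_field (F : Type*) [Field F] [Fintype F] {k n : ℕ} (hk0 : k ≠ 0)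
    (hk : k ∣ Fintype.card F - 1) (hn : Fintype.card F * (Fintype.card F - 1) ≤ k * n) :
    Fintype.card F * (Fintype.card F - 2) * (Fintype.card F - 1 - 6 * k) ≤
      6 * bergeEx 3 n (K2 (k + 1)) := by
  classical
  have h1 := mul_le_six_mul_card_cliqueFinset_powGraph hk
  have h2 := card_powGroup_mul hk
  have hV : Fintype.card (F × PowGroup F k) ≤ n := by
    rw [Fintype.card_prod]
    generalize Fintype.card (PowGroup F k) = m at *
    refine Nat.le_of_mul_le_mul_left (le_trans (le_of_eq ?_) hn) (Nat.pos_of_ne_zero hk0)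
    rw [← h2, mul_comm m k, mul_left_comm]
  have h3 := card_cliqueFinset_le_bergeEx_of_card_le (n := n) (r := 3) (by norm_num)
    (powGraph F k) (codegreeLE_powGraph hk hk0) hV
  have h4 := h1.trans (Nat.mul_le_mul_left 6 (le_of_eq_of_le (by congr!) h3))
  clear h1 h3 hV
  generalize Fintype.card (PowGroup F k) = m at *
  rw [← h2, ← Nat.sub_mul, mul_comm _ k, mul_left_comm]
  exact h4

/-- The lower bound for the Turán number obtained from the field with `q` elements. -/
lemma le_six_mul_bergeEx {q k n : ℕ} (hq : IsPrimePow q) (hk0 : k ≠ 0) (hk : k ∣ q - 1)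
    (hn : q * (q - 1) ≤ k * n) :
    q * (q - 2) * (q - 1 - 6 * k) ≤ 6 * bergeEx 3 n (K2 (k + 1)) := by
  obtain ⟨p, m, hp, hm, rfl⟩ := hq
  have : Fact p.Prime := ⟨hp.nat_prime⟩
  have : Fintype (GaloisField p m) := Fintype.ofFinite _
  have hc : Fintype.card (GaloisField p m) = p ^ m := by
    rw [← Nat.card_eq_fintype_card, GaloisField.card p m hm.ne']
  have h := le_six_mul_bergeEx_of_field (GaloisField p m) (k := k) (n := n) hk0
  rw [hc] at h
  exact h hk hn

lemma eventually_le_six_mul_bergeEx {k : ℕ} (hk : k ≠ 0) {η : ℝ} (h0 : 0 < η) (h1 : η < 1) :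
    ∀ᶠ n : ℕ in atTop, (1 - η) * Real.sqrt (k * n) ^ 3 ≤ 6 * (bergeEx 3 n (K2 (k + 1)) : ℝ) := by
  have : NeZero k := ⟨hk⟩
  have hk' : (0 : ℝ) < k := by exact_mod_cast Nat.pos_of_ne_zero hk
  set ρ : ℝ := 1 - η / 4 with hρ
  have hρ0 : 0 < ρ := by linarith
  have hδ : 0 < -Real.log ρ / 2 := by
    have := Real.log_neg hρ0 (by linarith)
    linarith
  have hX : Tendsto (fun n : ℕ => Real.sqrt (k * n)) atTop atTop :=
    Real.tendsto_sqrt_atTop.comp (tendsto_natCast_atTop_atTop.const_mul_atTop hk')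
  have hv : Tendsto (fun n : ℕ => Real.log (Real.sqrt (k * n)) - -Real.log ρ / 2) atTop atTop :=
    tendsto_atTop_add_const_right _ _ (Real.tendsto_log_atTop.comp hX)
  -- The window is centred at `log X + log ρ / 2` with half-width `-log ρ / 2`, so `ρX < q < X`. The
  -- threshold on `X` gives `6k + 2 ≤ ηX/12`, hence `q - (6k + 2) ≥ (1 - η/3)X`; Bernoulli's
  -- inequality then turns the cube into `1 - η`.
  filter_upwards [hv.eventually (eventually_exists_isPrimePow (m := k) isUnit_one hδ),
    hX.eventually_ge_atTop (12 * (6 * k + 2) / η), hX.eventually_gt_atTop 0] with n hn hc hpos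
  obtain ⟨q, hq, hqk, hlog⟩ := hn
  rw [abs_lt] at hlog
  set X := Real.sqrt (k * n) with hXdef
  have hq0 : (0 : ℝ) < q := by exact_mod_cast hq.pos
  have hqX : (q : ℝ) < X := (Real.log_lt_log_iff hq0 hpos).1 (by linarith)
  have hqρ : ρ * X < q := by
    rw [← Real.log_lt_log_iff (by positivity) hq0, Real.log_mul hρ0.ne' hpos.ne']
    linarith
  have hdvd : k ∣ q - 1 := by
    rw [← (ZMod.natCast_eq_zero_iff _ k), Nat.cast_sub hq.pos, hqk]
    simp
  have hsq : X ^ 2 = k * n := Real.sq_sqrt (by positivity)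
  have hqn : q * (q - 1) ≤ k * n := by
    have h2 : ((q * q : ℕ) : ℝ) ≤ ((k * n : ℕ) : ℝ) := by push_cast; nlinarith
    exact (Nat.mul_le_mul_left _ (Nat.sub_le _ _)).trans (by exact_mod_cast h2)
  have hmain := le_six_mul_bergeEx hq hk hdvd hqn
  rw [div_le_iff₀ h0] at hc
  have h3 : (1 - η / 3) * X ≤ q - (6 * k + 2) := by nlinarith
  have h4 : 0 ≤ (1 - η / 3) * X := mul_nonneg (by linarith) hpos.le
  have h5 : 6 * k + 2 ≤ q := by
    have : ((6 * k + 2 : ℕ) : ℝ) ≤ q := by push_cast; linarith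
    exact_mod_cast this
  have h6 : ((q : ℝ) - (6 * k + 2)) ^ 3 ≤ 6 * (bergeEx 3 n (K2 (k + 1)) : ℝ) := by
    have h7 : (q - (6 * k + 2)) ^ 3 ≤ 6 * bergeEx 3 n (K2 (k + 1)) := by
      refine le_trans ?_ hmain
      rw [pow_succ, sq]
      exact Nat.mul_le_mul (Nat.mul_le_mul (Nat.sub_le _ _) (by omega)) (by omega)
    have h8 : (((q - (6 * k + 2) : ℕ) : ℝ)) ^ 3 ≤ 6 * (bergeEx 3 n (K2 (k + 1)) : ℝ) := by
      exact_mod_cast h7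
    rw [Nat.cast_sub h5] at h8
    exact_mod_cast h8
  refine le_trans ?_ ((pow_le_pow_left₀ h4 h3 3).trans h6)
  rw [mul_pow]
  refine mul_le_mul_of_nonneg_right ?_ (by positivity)
  have := one_add_mul_le_pow (a := -(η / 3)) (by linarith) 3
  push_cast at this
  rw [← sub_eq_add_neg] at this
  linarith

lemma sqrt_pow_three (x : ℝ) (hx : 0 ≤ x) : Real.sqrt x ^ 3 = x ^ (3 / 2 : ℝ) := by
  rw [Real.sqrt_eq_rpow, ← Real.rpow_natCast, ← Real.rpow_mul hx]
  norm_num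

theorem bergeEx_three {t : ℕ} (ht : 4 ≤ t) : ∃ ε : ℕ → ℝ, Tendsto ε atTop (𝓝 0) ∧ ∀ n : ℕ,
    (bergeEx 3 n (K2 t) : ℝ) =
      (1 + ε n) * ((1 / 6) * ((t : ℝ) - 1) ^ (3 / 2 : ℝ)) * (n : ℝ) ^ (3 / 2 : ℝ) := by
  obtain ⟨ε₁, hε₁, h₁⟩ := bergeEx_le_of_lt (r := 3) (by norm_num) ht
  obtain ⟨k, rfl⟩ : ∃ k, t = k + 1 := ⟨t - 1, by omega⟩
  have hk : k ≠ 0 := by omega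
  have hk' : (0 : ℝ) < k := by exact_mod_cast Nat.pos_of_ne_zero hk
  -- At `r = 3` the constant of part (a) is exactly that of the construction.
  have hc : Real.sqrt (((k + 1 : ℕ) : ℝ) - 1) * (((k + 1).choose (3 - 1) : ℕ) : ℝ) /
      (((3 : ℕ) : ℝ) * ((k + 1 : ℕ) : ℝ)) = 1 / 6 * (k : ℝ) ^ (3 / 2 : ℝ) := by
    rw [← sqrt_pow_three _ hk'.le, Nat.cast_choose_two]
    push_cast
    rw [add_sub_cancel_right, pow_succ, Real.sq_sqrt hk'.le]
    field_simp
    ring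
  simp only [hc] at h₁
  have hcast : ((k + 1 : ℕ) : ℝ) - 1 = k := by push_cast; ring
  rw [hcast]
  set c : ℝ := 1 / 6 * (k : ℝ) ^ (3 / 2 : ℝ) with hcdef
  have hc0 : 0 < c := by positivity
  have hcn (n : ℕ) : 6 * (c * (n : ℝ) ^ (3 / 2 : ℝ)) = Real.sqrt (k * n) ^ 3 := by
    rw [sqrt_pow_three _ (by positivity), Real.mul_rpow hk'.le (Nat.cast_nonneg n), hcdef]
    ring
  have hpos {n : ℕ} (hn : 0 < n) : 0 < c * (n : ℝ) ^ (3 / 2 : ℝ) := by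
    have : (0 : ℝ) < n := Nat.cast_pos.2 hn
    positivity
  refine ⟨fun n => (bergeEx 3 n (K2 (k + 1)) : ℝ) / (c * (n : ℝ) ^ (3 / 2 : ℝ)) - 1, ?_,
    fun n => ?_⟩
  · rw [Metric.tendsto_atTop']
    intro η hη
    set η' := min (η / 2) (1 / 2) with hη'
    have hη0 : 0 < η' := by positivity
    have hηη : η' < η := (min_le_left _ _).trans_lt (by linarith)
    obtain ⟨N, hN⟩ := eventually_atTop.1 ((eventually_le_six_mul_bergeEx hk hη0
      ((min_le_right _ _).trans_lt (by norm_num))).and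
      ((hε₁.eventually (gt_mem_nhds hη)).and (eventually_gt_atTop 0)))
    refine ⟨N, fun n hn => ?_⟩
    obtain ⟨hlow, hup, hn0⟩ := hN n hn.le
    have hp := hpos hn0
    rw [Real.dist_eq, sub_zero, abs_lt]
    constructor
    · rw [← hcn] at hlow
      have : 1 - η' ≤ (bergeEx 3 n (K2 (k + 1)) : ℝ) / (c * (n : ℝ) ^ (3 / 2 : ℝ)) := by
        rw [le_div_iff₀ hp]
        linarith
      linarith
    · have : (bergeEx 3 n (K2 (k + 1)) : ℝ) / (c * (n : ℝ) ^ (3 / 2 : ℝ)) ≤ 1 + ε₁ n := by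
        rw [div_le_iff₀ hp, ← mul_assoc]
        exact h₁ n
      linarith
  -- At `n = 0` the quotient defining `ε` is a division by zero, but both sides of the equality
  -- vanish.
  · rcases Nat.eq_zero_or_pos n with rfl | hn
    · have := h₁ 0
      simp only [Nat.cast_zero, Real.zero_rpow (show (3 / 2 : ℝ) ≠ 0 by norm_num),
        mul_zero] at this ⊢
      exact le_antisymm this (Nat.cast_nonneg _)
    · rw [add_sub_cancel, mul_assoc, div_mul_cancel₀ _ (hpos hn).ne']

end BergeTuran

theorem mainTheorem9 :
    (∀ r t : ℕ, 1 ≤ r → r + 1 ≤ t →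
      ∃ ε : ℕ → ℝ, Tendsto ε atTop (𝓝 0) ∧ ∀ n : ℕ,
        (BergeTuran.bergeEx r n (BergeTuran.K2 t) : ℝ) ≤
          (1 + ε n) * (Real.sqrt ((t : ℝ) - 1) * (t.choose (r - 1) : ℝ) / ((r : ℝ) * (t : ℝ))) *
            (n : ℝ) ^ (3 / 2 : ℝ)) ∧
    (∀ r t : ℕ, 2 ≤ t → t ≤ r →
      ∃ ε : ℕ → ℝ, Tendsto ε atTop (𝓝 0) ∧ ∀ n : ℕ,
        (BergeTuran.bergeEx r n (BergeTuran.K2 t) : ℝ) ≤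
          (1 + ε n) * (Real.sqrt ((t : ℝ) - 1) / 2) * (n : ℝ) ^ (3 / 2 : ℝ)) ∧
    (∀ t : ℕ, 4 ≤ t →
      ∃ ε : ℕ → ℝ, Tendsto ε atTop (𝓝 0) ∧ ∀ n : ℕ,
        (BergeTuran.bergeEx 3 n (BergeTuran.K2 t) : ℝ) =
          (1 + ε n) * ((1 / 6) * ((t : ℝ) - 1) ^ (3 / 2 : ℝ)) * (n : ℝ) ^ (3 / 2 : ℝ)) :=
  ⟨fun _ _ hr ht => BergeTuran.bergeEx_le_of_lt hr ht,
    fun _ _ ht hr => BergeTuran.bergeEx_le_of_ge ht hr, fun _ ht => BergeTuran.bergeEx_three ht⟩
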